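/- Fix a non-principal ultrafilter $\omega$ on $\mathbb N$. For a metric space $Y$ let $\mathrm{Ball}(Y)$ be the $\sigma$-algebra generated by the open balls; for a measure $\mu$ on $\mathrm{Ball}(Y)$ put $\mathrm{spt}(\mu)=\{y\in Y:\mu(B(y,r))>0\ \forall r>0\}$, and call $\mu$ boundedly finite if all open balls have finite measure. A metric space is Polish if it is complete and separable (then $\mathrm{Ball}$ is the Borel $\sigma$-algebra). **Approximations.** Let $(Y,d_Y,q)$, $(Z,d_Z,z)$ be pointed Polish metric spaces and $0<\varepsilon<R$. An $(R,\varepsilon)$-approximation is a Borel map $\psi\colon B(q,R)\to Z$ with $\psi(q)=z$, $|d_Y(x,y)-d_Z(\psi(x),\psi(y))|\le\varepsilon$ for all $x,y\in B(q,R)$, and $B(z,R-\varepsilon)\subset\psi(B(q,R))^{\varepsilon}$ (open $\varepsilon$-neighbourhood). If $4\varepsilon<R$, a quasi-inverse of $\psi$ is an $(R-\varepsilon,3\varepsilon)$-approximation $\phi$ from $Z$ to $Y$ with $d_Y(x,\phi(\psi(x)))<3\varepsilon$ for $x\in B(q,R-4\varepsilon)$ and $d_Z(y,\psi(\phi(y)))<3\varepsilon$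 for $y\in B(z,R-\varepsilon)$. (The maps may be regarded as total maps whose values outside the balls are arbitrary.) **pmGH convergence.** Let $(X_i,d_i,\mathfrak m_i,p_i)$, $i\in\mathbb N\cup\{\infty\}$, be pointed Polish metric spaces with boundedly finite Borel measures. Maps $\psi_i$ realise the pmGH convergence $(X_i,d_i,\mathfrak m_i,p_i)\to(X_\infty,d_\infty,\mathfrak m_\infty,p_\infty)$ if they are $(R_i,\varepsilon_i)$-approximations from $X_i$ to $X_\infty$ for some $R_i\nearrow+\infty$ and $\varepsilon_i\searrow0$, and $\int_{B(p_i,R_i)}f\circ\psi_i\,d\mathfrak m_i\to\int f\,d\mathfrak m_\infty$ for every bounded continuous $f\colon X_\infty\to\mathbb R$ with bounded support. The spaces pmGH-converge if such maps exist. **Ultralimit.** Let $\bar X_\omega$ be the ultraproduct of the sets $X_i$, with the extended pseudodistance $\bar d_\omega([x_i],[y_i])=\lim_{i\to\omega}d_i(x_i,y_i)$, and $O=\{x\in\bar X_\omega:\bar d_\omega(x,[p_i])<\infty\}$. Let $\pi\colon O\to X_\omega$, $[x_i]\mapsto[[x_i]]$, be the quotient that identifies points at distance $0$, with the induced distance $d_\omega$,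 and $p_\omega=[[p_i]]$. For Borel sets $A_i\subset X_i$ let $\Pi A_i\subset\bar X_\omega$ be their ultraproduct and $\bar{\mathfrak m}_\omega(\Pi A_i\cap O)=\lim_{R\to\infty}\lim_{i\to\omega}\mathfrak m_i(A_i\cap B(p_i,R))$. A set $N\subset O$ is null if for all $\varepsilon>0$ it is contained in some such $\Pi A_i\cap O$ with $\bar{\mathfrak m}_\omega(\Pi A_i\cap O)<\varepsilon$. Let $\bar{\mathcal B}_\omega$ be the family of all $S\subset O$ such that for every $R>0$ there is $\bar A_R=\Pi A_i\cap O$ with $(S\cap\Pi B(p_i,R))\,\Delta\,\bar A_R$ null, and put $\bar{\mathfrak m}_\omega(S)=\lim_{R\to\infty}\bar{\mathfrak m}_\omega(\bar A_R)$. Finally $\mathfrak m_\omega(B)=\bar{\mathfrak m}_\omega(\pi^{-1}(B))$ for $B\in\mathrm{Ball}(X_\omega)$. **Theorem.** Suppose that $(X_i,d_i,\mathfrak m_i,p_i)$, as above, pmGH-converge to $(X_\infty,d_\infty,\mathfrak m_\infty,p_\infty)$. Then there is $\eta\colon(0,\infty)\to(0,\infty)$ such that for every $R>0$, $\mathfrak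 m_i(B(p_i,R))\le\eta(R)$ for $\omega$-a.e. $i$; $\pi^{-1}(B)\in\bar{\mathcal B}_\omega$ for every $B\in\mathrm{Ball}(X_\omega)$, and $\mathfrak m_\omega$ is a (countably additive) measure on $\mathrm{Ball}(X_\omega)$. Moreover $\mathrm{spt}(\mathfrak m_\omega)\in\mathrm{Ball}(X_\omega)$ and $\mathfrak m_\omega(X_\omega\setminus\mathrm{spt}(\mathfrak m_\omega))=0$. Let $\psi_i$ be any $(R_i,\varepsilon_i)$-approximations that realise the convergence. Then quasi-inverses $\phi_i$ of $\psi_i$ exist for all $i$ with $4\varepsilon_i<R_i$, and for every choice of them the map $\phi_\infty\colon X_\infty\to X_\omega$, $\phi_\infty(x)=[[\phi_i(x)]]$, is a well-defined isometric embedding with $\phi_\infty(p_\infty)=p_\omega$, measurable from the Borel $\sigma$-algebra to $\mathrm{Ball}(X_\omega)$, and $$\mathrm{spt}(\mathfrak m_\omega)=\phi_\infty(\mathrm{spt}(\mathfrak m_\infty)),\qquad(\phi_\infty)_*\mathfrak m_\infty=\mathfrak m_\omega .$$ In particular $\phi_\infty$ restricts to an isometric bijection $e\colon\mathrm{spt}(\mathfrak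 m_\infty)\to\mathrm{spt}(\mathfrak m_\omega)$ such that every Borel set $B\subset\mathrm{spt}(\mathfrak m_\omega)$ lies in $\mathrm{Ball}(X_\omega)$ and satisfies $\mathfrak m_\omega(B)=\mathfrak m_\infty(e^{-1}(B))$. -/

import Mathlib

open Filter Topology MeasureTheory Metric
open scoped ENNReal symmDiff

universe u v

namespace UltraMM

/-! ### Metric and measure terminology -/

/-- The ball `σ`-algebra of a metric space: the one generated by the open balls. -/
@[reducible] def ballSigma (Y : Type*) [PseudoMetricSpace Y] : MeasurableSpace Y :=
  MeasurableSpace.generateFrom {s | ∃ (y : Y) (r : ℝ), s = ball y r}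

/-- A measure is boundedly finite if all open balls have finite measure. -/
def BoundedlyFinite {Y : Type*} [PseudoMetricSpace Y] [MeasurableSpace Y]
    (μ : Measure Y) : Prop :=
  ∀ (y : Y) (r : ℝ), 0 < r → μ (ball y r) < ∞

/-- The support of a measure: the points all of whose balls have positive measure. -/
def spt {Y : Type*} [PseudoMetricSpace Y] [MeasurableSpace Y] (μ : Measure Y) : Set Y :=
  {y | ∀ r : ℝ, 0 < r → 0 < μ (ball y r)}

/-! ### Approximations and pointed measured Gromov-Hausdorff convergence -/

section Approx

variable {Y : Type*} {Z : Type*} [MetricSpace Y] [MeasurableSpace Y]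
  [MetricSpace Z] [MeasurableSpace Z]

/-- `ψ` is an `(R, ε)`-approximation from `(Y, q)` to `(Z, z)`. It is a map defined on the ball
`B(q, R)`; here it is given as a total map whose values outside that ball are irrelevant. -/
structure IsApprox (R ε : ℝ) (q : Y) (z : Z) (ψ : Y → Z) : Prop where
  eps_pos : 0 < ε
  eps_lt : ε < R
  measurable_on : Measurable fun x : ball q R => ψ x
  base : ψ q = z
  dist_le : ∀ x ∈ ball q R, ∀ y ∈ ball q R, |dist x y - dist (ψ x) (ψ y)| ≤ ε
  almost_onto : ball z (R - ε) ⊆ thickening ε (ψ '' ball q R)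

/-- `φ` is a quasi-inverse of the `(R, ε)`-approximation `ψ` from `(Y, q)` to `(Z, z)`. -/
structure IsQuasiInverse (R ε : ℝ) (q : Y) (z : Z) (ψ : Y → Z) (φ : Z → Y) : Prop where
  approx : IsApprox (R - ε) (3 * ε) z q φ
  left_inv : ∀ x ∈ ball q (R - 4 * ε), dist x (φ (ψ x)) < 3 * ε
  right_inv : ∀ y ∈ ball z (R - ε), dist y (ψ (φ y)) < 3 * ε

end Approx

section Convergence

variable {X : ℕ → Type u} [∀ i, MetricSpace (X i)] [∀ i, MeasurableSpace (X i)]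
  {Y : Type v} [MetricSpace Y] [MeasurableSpace Y]

/-- The maps `ψ i` are `(R i, ε i)`-approximations, with `R i ↗ ∞` and `ε i ↘ 0`, that realise
the pointed measured Gromov-Hausdorff convergence of `(X i, m i, p i)` to `(Y, μ, q)`.
As `ψ i` lives on `B(p i, R i)`, the integral of `f ∘ ψ i` is taken over that ball. -/
structure RealizesPmGH (p : ∀ i, X i) (m : ∀ i, Measure (X i)) (q : Y) (μ : Measure Y)
    (R ε : ℕ → ℝ) (ψ : ∀ i, X i → Y) : Prop where
  radius_mono : Monotone R
  radius_tendsto : Tendsto R atTop atTop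
  eps_anti : Antitone ε
  eps_tendsto : Tendsto ε atTop (𝓝 0)
  approx : ∀ i, IsApprox (R i) (ε i) (p i) q (ψ i)
  weak_conv : ∀ f : Y → ℝ, Continuous f → (∃ C, ∀ y, |f y| ≤ C) →
    Bornology.IsBounded (tsupport f) →
    Tendsto (fun i => ∫ x in ball (p i) (R i), f (ψ i x) ∂(m i)) atTop (𝓝 (∫ y, f y ∂μ))

/-- Pointed measured Gromov-Hausdorff convergence. -/
def PmGHConverges (p : ∀ i, X i) (m : ∀ i, Measure (X i)) (q : Y) (μ : Measure Y) : Prop :=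
  ∃ (R ε : ℕ → ℝ) (ψ : ∀ i, X i → Y), RealizesPmGH p m q μ R ε ψ

end Convergence

/-! ### The metric ultralimit -/

/-- Every sequence in `[0, ∞]` has an ultralimit. -/
theorem tendsto_limUnder_ultra (ω : Ultrafilter ℕ) (f : ℕ → ℝ≥0∞) :
    Tendsto f (ω : Filter ℕ) (𝓝 (limUnder (ω : Filter ℕ) f)) := by
  apply tendsto_nhds_limUnder
  obtain ⟨x, -, hx⟩ := isCompact_univ.ultrafilter_le_nhds (ω.map f) (by simp)
  exact ⟨x, hx⟩

section Ultralimit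

variable (ω : Ultrafilter ℕ) (X : ℕ → Type u)

/-- The ultraproduct of the sets `X i`: sequences modulo `ω`-almost everywhere equality. -/
def Ultraprod : Type u := Filter.Product (ω : Filter ℕ) X

variable {X}

/-- The class `[x i]` of a sequence in the ultraproduct. -/
def Ultraprod.mk (x : ∀ i, X i) : Ultraprod ω X :=
  @Quotient.mk _ ((ω : Filter ℕ).productSetoid X) x

variable [∀ i, MetricSpace (X i)]

/-- The extended pseudodistance of the ultraproduct: `lim_{i → ω} d_i(x_i, y_i)`. -/
noncomputable def Ultraprod.edistFun (x y : Ultraprod ω X) : ℝ≥0∞ :=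
  Quotient.liftOn₂ x y (fun a b => limUnder (ω : Filter ℕ) fun i => edist (a i) (b i)) (by
    intro a b a' b' ha hb
    have ha' : ∀ᶠ i in (ω : Filter ℕ), a i = a' i := ha
    have hb' : ∀ᶠ i in (ω : Filter ℕ), b i = b' i := hb
    refine (Tendsto.limUnder_eq ?_)
    refine (tendsto_limUnder_ultra ω fun i => edist (a' i) (b' i)).congr' ?_
    filter_upwards [ha', hb'] with i h1 h2
    rw [h1, h2])

noncomputable instance : PseudoEMetricSpace (Ultraprod ω X) where
  edist := Ultraprod.edistFun ω
  edist_self x := by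
    induction x using Quotient.inductionOn with
    | h a =>
      change limUnder (ω : Filter ℕ) (fun i => edist (a i) (a i)) = 0
      refine Tendsto.limUnder_eq ?_
      simp
  edist_comm x y := by
    induction x using Quotient.inductionOn with
    | h a =>
      induction y using Quotient.inductionOn with
      | h b =>
        change limUnder (ω : Filter ℕ) (fun i => edist (a i) (b i)) =
          limUnder (ω : Filter ℕ) (fun i => edist (b i) (a i))
        simp only [edist_comm]
  edist_triangle x y z := by
    induction x using Quotient.inductionOn with
    | h a =>
      induction y using Quotient.inductionOn with
      | h b =>
        induction z using Quotient.inductionOn with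
        | h c =>
          exact le_of_tendsto_of_tendsto' (tendsto_limUnder_ultra ω fun i => edist (a i) (c i))
            ((tendsto_limUnder_ultra ω fun i => edist (a i) (b i)).add
              (tendsto_limUnder_ultra ω fun i => edist (b i) (c i)))
            (fun i => edist_triangle (a i) (b i) (c i))

/-- The points of the ultraproduct at finite distance from the base point `[p i]`. -/
def finiteSet (p : ∀ i, X i) : Set (Ultraprod ω X) :=
  {x | edist x (Ultraprod.mk ω p) < ∞}

/-- The set-theoretic ultralimit of the pointed metric spaces `(X i, p i)`. -/
def FinitePart (p : ∀ i, X i) : Type u := finiteSet ω p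

noncomputable instance (p : ∀ i, X i) : PseudoMetricSpace (FinitePart ω p) :=
  @PseudoEMetricSpace.toPseudoMetricSpace (finiteSet ω p) inferInstance fun x y => by
    refine ne_top_of_le_ne_top ?_ (edist_triangle_right x.1 y.1 (Ultraprod.mk ω p))
    exact (ENNReal.add_lt_top.2 ⟨x.2, y.2⟩).ne

theorem base_mem (p : ∀ i, X i) : Ultraprod.mk ω p ∈ finiteSet ω p := by
  simp [finiteSet]

/-- The ultralimit of the pointed metric spaces `(X i, p i)`: points of the finite part at
distance zero are identified. -/
def Ultralimit (p : ∀ i, X i) : Type u := SeparationQuotient (FinitePart ω p)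

noncomputable instance (p : ∀ i, X i) : MetricSpace (Ultralimit ω p) :=
  inferInstanceAs (MetricSpace (SeparationQuotient (FinitePart ω p)))

/-- The ultralimit always carries its ball `σ`-algebra (which may be smaller than the Borel
`σ`-algebra). -/
noncomputable instance (p : ∀ i, X i) : MeasurableSpace (Ultralimit ω p) := ballSigma (Ultralimit ω p)

/-- The projection `[x i] ↦ [[x i]]` of the finite part onto the ultralimit. -/
noncomputable def proj (p : ∀ i, X i) : FinitePart ω p → Ultralimit ω p := SeparationQuotient.mk

/-- The base point `[[p i]]` of the ultralimit. -/
noncomputable def basePoint (p : ∀ i, X i) : Ultralimit ω p := proj ω p ⟨Ultraprod.mk ω p, base_mem ω p⟩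

open Classical in
/-- The map `x ↦ [[φ i x]]` into the ultralimit (with a dummy value at those `x` for which
`[φ i x]` is not in the finite part). -/
noncomputable def limitMap {Y : Type v} (p : ∀ i, X i) (φ : ∀ i, Y → X i) (x : Y) :
    Ultralimit ω p :=
  if h : Ultraprod.mk ω (fun i => φ i x) ∈ finiteSet ω p then
    proj ω p ⟨Ultraprod.mk ω (fun i => φ i x), h⟩
  else basePoint ω p

/-! ### The ultralimit measure

The `σ`-algebra of `X i` is the one on which `m i` is defined; in a separable space with the
Borel `σ`-algebra it is the ball `σ`-algebra. Internal measurable sets are handled through the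
sequences `A` of measurable sets that represent them. -/

/-- The trace on the finite part of the internal set given by the ultraproduct of the `A i`. -/
def internal (p : ∀ i, X i) (A : ∀ i, Set (X i)) : Set (FinitePart ω p) :=
  {x | ∃ a : ∀ i, X i, Ultraprod.mk ω a = x.1 ∧ ∀ᶠ i in (ω : Filter ℕ), a i ∈ A i}

variable [∀ i, MeasurableSpace (X i)]

/-- The finitely additive measure of the set `internal ω p A`:
`lim_{R → ∞} lim_{i → ω} m_i (A_i ∩ B(p_i, R))`. -/
noncomputable def preMeasure (p : ∀ i, X i) (m : ∀ i, Measure (X i)) (A : ∀ i, Set (X i)) :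
    ℝ≥0∞ :=
  limUnder (atTop : Filter ℝ) fun R =>
    limUnder (ω : Filter ℕ) fun i => m i (A i ∩ ball (p i) R)

/-- Null sets: those covered by traces of internal measurable sets of arbitrarily small
measure. -/
def IsNull (p : ∀ i, X i) (m : ∀ i, Measure (X i)) (N : Set (FinitePart ω p)) : Prop :=
  ∀ ε : ℝ≥0∞, 0 < ε → ∃ A : ∀ i, Set (X i),
    (∀ i, MeasurableSet (A i)) ∧ N ⊆ internal ω p A ∧ preMeasure ω p m A < ε

/-- The trace of the internal measurable set represented by `A` agrees, up to a null set, with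
the part of `S` inside the internal ball of radius `R`. -/
def IsInternalApprox (p : ∀ i, X i) (m : ∀ i, Measure (X i)) (S : Set (FinitePart ω p)) (R : ℝ)
    (A : ∀ i, Set (X i)) : Prop :=
  (∀ i, MeasurableSet (A i)) ∧
    IsNull ω p m ((S ∩ internal ω p fun i => ball (p i) R) ∆ internal ω p A)

/-- The sets on which the measure of the finite part is defined. -/
def barSigma (p : ∀ i, X i) (m : ∀ i, Measure (X i)) : Set (Set (FinitePart ω p)) :=
  {S | ∀ R : ℝ, 0 < R → ∃ A, IsInternalApprox ω p m S R A}

open Classical in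
/-- The measure of the finite part: the limit as `R → ∞` of the measures of internal
approximations of the part of `S` inside the internal ball of radius `R`. -/
noncomputable def barMeasure (p : ∀ i, X i) (m : ∀ i, Measure (X i))
    (S : Set (FinitePart ω p)) : ℝ≥0∞ :=
  limUnder (atTop : Filter ℝ) fun R =>
    preMeasure ω p m
      (if h : ∃ A, IsInternalApprox ω p m S R A then h.choose else fun _ => ∅)

/-- Uniform bounded finiteness along the ultrafilter. -/
def UniformlyBoundedlyFinite (p : ∀ i, X i) (m : ∀ i, Measure (X i)) : Prop :=
  ∃ η : ℝ → ℝ, (∀ R, 0 < R → 0 < η R) ∧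
    ∀ R, 0 < R → ∀ᶠ i in (ω : Filter ℕ), m i (ball (p i) R) ≤ ENNReal.ofReal (η R)

/-- The push-forward of `barMeasure` under `proj` is countably additive on the ball
`σ`-algebra of the ultralimit. -/
def PushforwardIsMeasure (p : ∀ i, X i) (m : ∀ i, Measure (X i)) : Prop :=
  barMeasure ω p m (proj ω p ⁻¹' ∅) = 0 ∧
    ∀ f : ℕ → Set (Ultralimit ω p), (∀ n, MeasurableSet (f n)) →
      Pairwise (Function.onFun Disjoint f) →
      barMeasure ω p m (proj ω p ⁻¹' ⋃ n, f n) = ∑' n, barMeasure ω p m (proj ω p ⁻¹' f n)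

open Classical in
/-- The ultralimit measure: the push-forward of `barMeasure` under `proj`, restricted to the
ball `σ`-algebra of the ultralimit. -/
noncomputable def ultralimitMeasure (p : ∀ i, X i) (m : ∀ i, Measure (X i)) :
    Measure (Ultralimit ω p) :=
  if h : PushforwardIsMeasure ω p m then
    Measure.ofMeasurable (fun B _ => barMeasure ω p m (proj ω p ⁻¹' B)) h.1
      (fun f hf hd => h.2 f hf hd)
  else 0

/-- The ultralimit measure is well posed: the sequence is uniformly boundedly finite, the
preimage of each ball-measurable set is in the domain of `barMeasure`, and the ultralimit
measure is the push-forward of `barMeasure`. -/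
structure UltralimitMeasureWellPosed (p : ∀ i, X i) (m : ∀ i, Measure (X i)) : Prop where
  bounded : UniformlyBoundedlyFinite ω p m
  isMeasure : PushforwardIsMeasure ω p m
  mem_barSigma : ∀ B : Set (Ultralimit ω p), MeasurableSet B →
    proj ω p ⁻¹' B ∈ barSigma ω p m
  apply_eq : ∀ B : Set (Ultralimit ω p), MeasurableSet B →
    ultralimitMeasure ω p m B = barMeasure ω p m (proj ω p ⁻¹' B)

end Ultralimit

end UltraMM

open UltraMM

namespace UltraMM

/-! ### Sequences representing points and internal sets -/

/-! The heart of the matter is one identity: if the pullback `E = φ_∞⁻¹(B)` of a set `B` of the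
ultralimit is Borel in the limit space, then `π⁻¹(B)` lies in the domain of the ultraproduct measure
and has measure `μ(E)` (`RealizesPmGH.barSigma_and_barMeasure`). As `φ_∞` is continuous, this
applies to every ball-measurable `B`. Countable additivity is then inherited from `μ`, and the
ultralimit measure is the push-forward of `μ`.

To prove it, fill a large ball up to measure `1/(n+1)` by compact sets `K n ⊆ E` and `L n ⊆ Eᶜ`,
increasing in `n`. The internal approximation of `π⁻¹(B)` consists of the points that `ψ i` maps
within `t i` of `K (κ i)`, where `κ` tends to infinity and `t` to zero so slowly that weak
convergence still controls the masses. A sequence `a` whose images `ψ i (a i)` stay `t i`-close to a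
fixed `K n` or `L n` has image converging along `ω` to a point `y` of that compact set, and then
`[[a i]] = φ_∞ y` (`RealizesPmGH.proj_eq_limitMap`). Thus membership in `B` is decided correctly
except where `ψ i` maps far from `K n ∪ L n`, an internal set of measure at most `1/(n+1)`; as `n`
is arbitrary, the error is null (`IsTestPair.isInternalApprox`). Portmanteau inequalities squeeze
the mass of the approximation between `μ(E ∩ B(q, r - 2))` and `μ(E)`.

The ultralimit need not be separable, so its ball `σ`-algebra may miss open sets. Isometric images
of Borel sets of a Polish space are nevertheless ball-measurable, since such an image of a closed
set is a countable intersection of countable unions of balls. This transfers supports and Borel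
subsets of supports. -/

theorem ultra_le_atTop {ω : Ultrafilter ℕ} (hω : ∀ n : ℕ, ({n} : Set ℕ) ∉ ω) :
    (ω : Filter ℕ) ≤ atTop := by
  rw [← Nat.cofinite_eq_atTop]
  intro s hs
  by_contra h
  rw [Ultrafilter.mem_coe, ← Ultrafilter.compl_mem_iff_notMem] at h
  obtain ⟨n, -, hn⟩ := (Ultrafilter.finite_biUnion_mem_iff (f := ω) (is := sᶜ)
    (s := fun n => ({n} : Set ℕ)) (Filter.mem_cofinite.1 hs)).1 (by rwa [Set.biUnion_of_singleton])
  exact hω n hn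

section Points

variable {ω : Ultrafilter ℕ} {X : ℕ → Type u}

theorem Ultraprod.mk_eq_mk {a b : ∀ i, X i} :
    Ultraprod.mk ω a = Ultraprod.mk ω b ↔ ∀ᶠ i in (ω : Filter ℕ), a i = b i :=
  @Quotient.eq _ ((ω : Filter ℕ).productSetoid X) a b

variable [∀ i, MetricSpace (X i)] {p : ∀ i, X i}

theorem Ultraprod.tendsto_edist (a b : ∀ i, X i) :
    Tendsto (fun i => edist (a i) (b i)) (ω : Filter ℕ)
      (𝓝 (edist (Ultraprod.mk ω a) (Ultraprod.mk ω b))) :=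
  tendsto_limUnder_ultra ω fun i => edist (a i) (b i)

theorem Ultraprod.edist_eq_of_tendsto {a b : ∀ i, X i} {c : ℝ≥0∞}
    (h : Tendsto (fun i => edist (a i) (b i)) (ω : Filter ℕ) (𝓝 c)) :
    edist (Ultraprod.mk ω a) (Ultraprod.mk ω b) = c :=
  tendsto_nhds_unique (Ultraprod.tendsto_edist a b) h

theorem mem_finiteSet_of_eventually {a : ∀ i, X i} {r : ℝ}
    (h : ∀ᶠ i in (ω : Filter ℕ), a i ∈ ball (p i) r) : Ultraprod.mk ω a ∈ finiteSet ω p := by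
  refine lt_of_le_of_lt (le_of_tendsto (Ultraprod.tendsto_edist a p) ?_)
    (ENNReal.ofReal_lt_top (r := r))
  filter_upwards [h] with i hi
  rw [edist_dist]
  exact ENNReal.ofReal_le_ofReal (le_of_lt hi)

theorem FinitePart.exists_rep (x : FinitePart ω p) :
    ∃ (a : ∀ i, X i) (h : Ultraprod.mk ω a ∈ finiteSet ω p), x = ⟨Ultraprod.mk ω a, h⟩ := by
  obtain ⟨y, hy⟩ := x
  induction y using Quotient.inductionOn with
  | h a => exact ⟨a, hy, rfl⟩

theorem mem_internal_mk {a : ∀ i, X i} (h : Ultraprod.mk ω a ∈ finiteSet ω p)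
    {A : ∀ i, Set (X i)} :
    (⟨Ultraprod.mk ω a, h⟩ : FinitePart ω p) ∈ internal ω p A ↔
      ∀ᶠ i in (ω : Filter ℕ), a i ∈ A i := by
  constructor
  · rintro ⟨b, hb, hbA⟩
    filter_upwards [Ultraprod.mk_eq_mk.1 hb, hbA] with i h1 h2
    exact h1 ▸ h2
  · exact fun h => ⟨a, rfl, h⟩

theorem edist_proj_mk {a b : ∀ i, X i} (ha : Ultraprod.mk ω a ∈ finiteSet ω p)
    (hb : Ultraprod.mk ω b ∈ finiteSet ω p) :
    edist (proj ω p ⟨Ultraprod.mk ω a, ha⟩) (proj ω p ⟨Ultraprod.mk ω b, hb⟩) =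
      edist (Ultraprod.mk ω a) (Ultraprod.mk ω b) :=
  SeparationQuotient.edist_mk _ _

theorem proj_mk_eq_of_tendsto {a b : ∀ i, X i} (ha : Ultraprod.mk ω a ∈ finiteSet ω p)
    (hb : Ultraprod.mk ω b ∈ finiteSet ω p)
    (h : Tendsto (fun i => dist (a i) (b i)) (ω : Filter ℕ) (𝓝 0)) :
    proj ω p ⟨Ultraprod.mk ω a, ha⟩ = proj ω p ⟨Ultraprod.mk ω b, hb⟩ := by
  rw [← edist_eq_zero, edist_proj_mk]
  apply Ultraprod.edist_eq_of_tendsto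
  simpa [edist_dist] using ENNReal.tendsto_ofReal h

/-- Counterexamples chosen for `ω`-almost every `i` would form a point of the ultraproduct; the
bound `r` puts it in the finite part, where the inclusion of traces refutes it. -/
theorem eventually_subset_of_internal_subset {A B : ∀ i, Set (X i)}
    (h : internal ω p A ⊆ internal ω p B) (r : ℝ) :
    ∀ᶠ i in (ω : Filter ℕ), A i ∩ ball (p i) r ⊆ B i := by
  classical
  by_contra hcon
  rw [← Ultrafilter.eventually_not] at hcon
  have hex : ∀ i, ∃ x : X i, ¬ (A i ∩ ball (p i) r ⊆ B i) → (x ∈ A i ∩ ball (p i) r ∧ x ∉ B i) := by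
    intro i
    by_cases hi : A i ∩ ball (p i) r ⊆ B i
    -- An arbitrary value: such indices form an `ω`-negligible set.
    · exact ⟨p i, fun h => (h hi).elim⟩
    · obtain ⟨x, hx⟩ := Set.not_subset.1 hi
      exact ⟨x, fun _ => hx⟩
  choose a ha using hex
  have hfin : Ultraprod.mk ω a ∈ finiteSet ω p :=
    mem_finiteSet_of_eventually (hcon.mono fun i hi => (ha i hi).1.2)
  have hB := (mem_internal_mk hfin).1
    (h ((mem_internal_mk hfin).2 (hcon.mono fun i hi => (ha i hi).1.1)))
  obtain ⟨i, hi, hi'⟩ := (hcon.and hB).exists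
  exact (ha i hi).2 hi'

end Points

/-! ### The finitely additive measure of internal sets -/

section PreMeasure

variable {ω : Ultrafilter ℕ} {X : ℕ → Type u} [∀ i, MetricSpace (X i)]
  [∀ i, MeasurableSpace (X i)] {p : ∀ i, X i} {m : ∀ i, Measure (X i)}

theorem limUnder_ultra_mono {f g : ℕ → ℝ≥0∞} (h : ∀ᶠ i in (ω : Filter ℕ), f i ≤ g i) :
    limUnder (ω : Filter ℕ) f ≤ limUnder (ω : Filter ℕ) g :=
  le_of_tendsto_of_tendsto (tendsto_limUnder_ultra ω f) (tendsto_limUnder_ultra ω g) h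

theorem preMeasure_eq_iSup (A : ∀ i, Set (X i)) :
    preMeasure ω p m A = ⨆ r : ℝ, limUnder (ω : Filter ℕ) fun i => m i (A i ∩ ball (p i) r) := by
  refine Tendsto.limUnder_eq (tendsto_atTop_iSup fun r s hrs => limUnder_ultra_mono ?_)
  exact Eventually.of_forall fun i =>
    measure_mono (Set.inter_subset_inter_right _ (ball_subset_ball hrs))

theorem preMeasure_le_of_eventually {A : ∀ i, Set (X i)} {c : ℝ≥0∞}
    (h : ∀ᶠ i in (ω : Filter ℕ), m i (A i) ≤ c) : preMeasure ω p m A ≤ c := by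
  rw [preMeasure_eq_iSup]
  refine iSup_le fun r => le_of_tendsto (tendsto_limUnder_ultra ω _) ?_
  filter_upwards [h] with i hi
  exact (measure_mono Set.inter_subset_left).trans hi

theorem le_preMeasure_of_eventually {A : ∀ i, Set (X i)} {c : ℝ≥0∞} (r : ℝ)
    (h : ∀ᶠ i in (ω : Filter ℕ), c ≤ m i (A i ∩ ball (p i) r)) : c ≤ preMeasure ω p m A := by
  rw [preMeasure_eq_iSup]
  exact le_iSup_of_le r (ge_of_tendsto (tendsto_limUnder_ultra ω _) h)

theorem preMeasure_le_add {A B C : ∀ i, Set (X i)}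
    (h : internal ω p A ⊆ internal ω p B ∪ internal ω p C) :
    preMeasure ω p m A ≤ preMeasure ω p m B + preMeasure ω p m C := by
  have h' : internal ω p A ⊆ internal ω p fun i => B i ∪ C i := by
    intro x hx
    rcases h hx with ⟨a, ha, hA⟩ | ⟨a, ha, hA⟩
    · exact ⟨a, ha, hA.mono fun i => Or.inl⟩
    · exact ⟨a, ha, hA.mono fun i => Or.inr⟩
  rw [preMeasure_eq_iSup A]
  refine iSup_le fun r => ?_
  refine (le_of_tendsto_of_tendsto (tendsto_limUnder_ultra ω _)
    ((tendsto_limUnder_ultra ω fun i => m i (B i ∩ ball (p i) r)).add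
      (tendsto_limUnder_ultra ω fun i => m i (C i ∩ ball (p i) r))) ?_).trans
    (add_le_add ?_ ?_)
  · filter_upwards [eventually_subset_of_internal_subset h' r] with i hi
    refine (measure_mono fun x hx => ?_).trans (measure_union_le _ _)
    exact (hi hx).imp (fun h => ⟨h, hx.2⟩) fun h => ⟨h, hx.2⟩
  · rw [preMeasure_eq_iSup]
    exact le_iSup (fun r : ℝ => limUnder (ω : Filter ℕ) fun i => m i (B i ∩ ball (p i) r)) r
  · rw [preMeasure_eq_iSup]
    exact le_iSup (fun r : ℝ => limUnder (ω : Filter ℕ) fun i => m i (C i ∩ ball (p i) r)) r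

/-- Used in both directions, this makes the value in `barMeasure` independent of the chosen
approximation: `A` is covered by `B` together with covers of the two null errors. -/
theorem IsInternalApprox.preMeasure_le {S : Set (FinitePart ω p)} {r : ℝ} {A B : ∀ i, Set (X i)}
    (hA : IsInternalApprox ω p m S r A) (hB : IsInternalApprox ω p m S r B) :
    preMeasure ω p m A ≤ preMeasure ω p m B := by
  refine ENNReal.le_of_forall_pos_le_add fun ε hε _ => ?_
  have hε' : (0 : ℝ≥0∞) < ε / 2 := ENNReal.half_pos (by simpa using hε.ne')
  obtain ⟨C, -, hC, hCε⟩ := hA.2 _ hε'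
  obtain ⟨D, -, hD, hDε⟩ := hB.2 _ hε'
  have h1 : preMeasure ω p m (fun i => C i ∪ D i) ≤ ε := by
    refine (preMeasure_le_add (B := C) (C := D) ?_).trans
      ((add_le_add hCε.le hDε.le).trans_eq (ENNReal.add_halves _))
    rintro x ⟨a, ha, h⟩
    -- Only for an ultrafilter does a disjunction holding almost everywhere split, so that traces
    -- commute with finite unions.
    exact (Ultrafilter.eventually_or.1 h).imp (fun h => ⟨a, ha, h⟩) fun h => ⟨a, ha, h⟩
  refine (preMeasure_le_add (B := B) (C := fun i => C i ∪ D i) ?_).trans (by gcongr)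
  intro x hx
  by_cases hxB : x ∈ internal ω p B
  · exact Or.inl hxB
  · right
    by_cases hxS : x ∈ S ∩ internal ω p fun i => ball (p i) r
    · obtain ⟨a, ha, h⟩ := hD (Or.inl ⟨hxS, hxB⟩)
      exact ⟨a, ha, h.mono fun i => Or.inr⟩
    · obtain ⟨a, ha, h⟩ := hC (Or.inr ⟨hx, hxS⟩)
      exact ⟨a, ha, h.mono fun i => Or.inl⟩

theorem barMeasure_eq_of_tendsto {S : Set (FinitePart ω p)} {A : ℝ → ∀ i, Set (X i)} {c : ℝ≥0∞}
    (hA : ∀ r, 0 < r → IsInternalApprox ω p m S r (A r))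
    (hc : Tendsto (fun r => preMeasure ω p m (A r)) atTop (𝓝 c)) :
    barMeasure ω p m S = c := by
  refine Tendsto.limUnder_eq (hc.congr' ?_)
  filter_upwards [eventually_gt_atTop 0] with r hr
  have h : ∃ A, IsInternalApprox ω p m S r A := ⟨A r, hA r hr⟩
  rw [dif_pos h]
  exact le_antisymm ((hA r hr).preMeasure_le h.choose_spec)
    (h.choose_spec.preMeasure_le (hA r hr))

end PreMeasure

/-! ### Quasi-inverses -/

section QuasiInverse

variable {Y : Type*} {Z : Type*} [MetricSpace Y] [MeasurableSpace Y]
  [MetricSpace Z] [MeasurableSpace Z] {R ε : ℝ} {q : Y} {z : Z} {ψ : Y → Z}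

theorem IsApprox.dist_base_lt (h : IsApprox R ε q z ψ) {x : Y} {r : ℝ} (hr : r ≤ R)
    (hx : x ∈ ball q r) : dist (ψ x) z < r + ε := by
  have hR : 0 < R := h.eps_pos.trans h.eps_lt
  have h1 := abs_le.1 (h.dist_le x (ball_subset_ball hr hx) q (mem_ball_self hR))
  rw [h.base] at h1
  linarith [mem_ball.1 hx]

/-- Send `y` to the first of countably many points whose `ψ`-image is `ε`-close to `y`; taking the
first index makes the choice measurable. Two errors `ε` and the distortion of `ψ` add up to `3 * ε`.
-/
theorem IsApprox.exists_isQuasiInverse [TopologicalSpace.SeparableSpace Z]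
    [OpensMeasurableSpace Z] (h : IsApprox R ε q z ψ) (hR : 4 * ε < R) :
    ∃ φ : Z → Y, IsQuasiInverse R ε q z ψ φ := by
  classical
  have hε := h.eps_pos
  have hR0 : 0 < R := hε.trans h.eps_lt
  have hsep : TopologicalSpace.IsSeparable (ψ '' ball q R) :=
    TopologicalSpace.IsSeparable.of_separableSpace _
  obtain ⟨D, hDsub, hDc, hDd⟩ := hsep.exists_countable_dense_subset
  have hDne : D.Nonempty := by
    by_contra hD
    rw [Set.not_nonempty_iff_eq_empty.1 hD, closure_empty] at hDd
    exact hDd (Set.mem_image_of_mem ψ (mem_ball_self hR0))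
  obtain ⟨d, hd⟩ := hDc.exists_eq_range hDne
  have hpre : ∀ n, ∃ x ∈ ball q R, ψ x = d n := fun n => hDsub (hd ▸ Set.mem_range_self n)
  choose a haR had using hpre
  -- Index `0` is reserved for `q`: since `ψ q = z`, the search at `z` stops there, which yields `φ
  -- z = q` exactly.
  let b : ℕ → Y := fun n => Nat.casesOn n q a
  have hbR : ∀ n, b n ∈ ball q R := fun n => by
    cases n with
    | zero => exact mem_ball_self hR0
    | succ k => exact haR k
  have hex : ∀ y : ball z (R - ε), ∃ n, dist (y : Z) (ψ (b n)) < ε := by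
    intro y
    obtain ⟨w, hw, hyw⟩ := mem_thickening_iff.1 (h.almost_onto y.2)
    obtain ⟨w', hw', hww'⟩ := Metric.mem_closure_iff.1 (hDd hw) _ (sub_pos.2 hyw)
    rw [hd] at hw'
    obtain ⟨n, rfl⟩ := hw'
    refine ⟨n + 1, ?_⟩
    change dist (y : Z) (ψ (a n)) < ε
    rw [had]
    linarith [dist_triangle (y : Z) w (d n)]
  let φ : Z → Y := fun y => if hy : y ∈ ball z (R - ε) then b (Nat.find (hex ⟨y, hy⟩)) else q
  have hφ : ∀ y : ball z (R - ε), φ y = b (Nat.find (hex y)) := fun y => dif_pos y.2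
  have hφR : ∀ y ∈ ball z (R - ε), φ y ∈ ball q R := fun y hy => by
    rw [hφ ⟨y, hy⟩]
    exact hbR _
  have hφd : ∀ y ∈ ball z (R - ε), dist y (ψ (φ y)) < ε := fun y hy => by
    rw [hφ ⟨y, hy⟩]
    exact Nat.find_spec (hex ⟨y, hy⟩)
  have hψ : ∀ x ∈ ball q (R - 4 * ε), ψ x ∈ ball z (R - ε) := fun x hx => by
    have := h.dist_base_lt (by linarith) hx
    exact mem_ball.2 (by linarith)
  have hleft : ∀ x ∈ ball q (R - 4 * ε), dist x (φ (ψ x)) < 3 * ε := fun x hx => by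
    have h1 := abs_le.1 (h.dist_le x (ball_subset_ball (by linarith) hx) _ (hφR _ (hψ x hx)))
    linarith [hφd _ (hψ x hx)]
  refine ⟨φ, ⟨⟨by linarith, by linarith, ?_, ?_, ?_, ?_⟩, hleft, fun y hy => ?_⟩⟩
  · have : (fun y : ball z (R - ε) => φ y) = fun y => b (Nat.find (hex y)) := funext hφ
    rw [this]
    refine (measurable_from_nat (f := b)).comp (measurable_find hex fun k => ?_)
    exact (isOpen_lt (by fun_prop) continuous_const).measurableSet
  · have hz : z ∈ ball z (R - ε) := mem_ball_self (by linarith)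
    have h0 : dist z (ψ q) < ε := by rwa [h.base, dist_self]
    rw [hφ ⟨z, hz⟩, (Nat.find_eq_zero (hex ⟨z, hz⟩)).2 h0]
    rfl
  · intro x hx y hy
    have h1 := abs_le.1 (h.dist_le _ (hφR x hx) _ (hφR y hy))
    have h2 := hφd x hx
    have h3 := hφd y hy
    have h4 := dist_triangle4 x (ψ (φ x)) (ψ (φ y)) y
    have h5 := dist_triangle4 (ψ (φ x)) x y (ψ (φ y))
    rw [dist_comm (ψ (φ y)) y] at h4
    rw [dist_comm (ψ (φ x)) x] at h5
    exact abs_le.2 ⟨by linarith, by linarith⟩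
  · intro x hx
    have hx' : x ∈ ball q (R - 4 * ε) := by convert hx using 2; ring
    exact mem_thickening_iff.2 ⟨φ (ψ x), Set.mem_image_of_mem φ (hψ x hx'), hleft x hx'⟩
  · linarith [hφd y hy]

end QuasiInverse

/-! ### Convergence of masses -/

theorem BoundedlyFinite.lt_top {Y : Type*} [MetricSpace Y] [MeasurableSpace Y] {μ : Measure Y}
    (hμ : BoundedlyFinite μ) {C : Set Y}
    (hC : Bornology.IsBounded C) : μ C < ∞ := by
  rcases C.eq_empty_or_nonempty with rfl | ⟨y, -⟩
  · simp
  · obtain ⟨r, hr⟩ := hC.subset_ball y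
    exact (measure_mono (hr.trans (ball_subset_ball (le_max_left r 1)))).trans_lt
      (hμ y _ (lt_max_of_lt_right one_pos))

theorem IsApprox.measurableSet_preimage {Y Z : Type*} [MetricSpace Y] [MeasurableSpace Y]
    [MetricSpace Z] [MeasurableSpace Z] [OpensMeasurableSpace Y] {q : Y} {z : Z} {R ε r : ℝ}
    {ψ : Y → Z} (h : IsApprox R ε q z ψ) (hr : r ≤ R) {E : Set Z} (hE : MeasurableSet E) :
    MeasurableSet (ball q r ∩ ψ ⁻¹' E) := by
  have h1 : MeasurableSet (ball q R ∩ ψ ⁻¹' E) := by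
    have := isOpen_ball.measurableSet.subtype_image (h.measurable_on hE)
    convert this using 1
    ext x
    simp [and_comm]
  convert (isOpen_ball (x := q) (ε := r)).measurableSet.inter h1 using 1
  rw [← Set.inter_assoc, Set.inter_eq_left.2 (ball_subset_ball hr)]

section Weak

variable {X : ℕ → Type u} [∀ i, MetricSpace (X i)] [∀ i, MeasurableSpace (X i)]
  {Y : Type v} [MetricSpace Y] [MeasurableSpace Y]
  {p : ∀ i, X i} {m : ∀ i, Measure (X i)} {q : Y} {μ : Measure Y}
  {R ε : ℕ → ℝ} {ψ : ∀ i, X i → Y}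

theorem RealizesPmGH.eventually_radius (h : RealizesPmGH p m q μ R ε ψ) (c k : ℝ) :
    ∀ᶠ i in atTop, c + k * ε i < R i := by
  have h1 : Tendsto (fun i => c + k * ε i) atTop (𝓝 (c + k * 0)) :=
    (h.eps_tendsto.const_mul k).const_add c
  filter_upwards [h1.eventually_lt_const (lt_add_one _), h.radius_tendsto.eventually_ge_atTop
    (c + k * 0 + 1)] with i hi hi'
  exact hi.trans_le hi'

variable [∀ i, BorelSpace (X i)] [BorelSpace Y]

/-- The thickened indicator is a bounded continuous function of bounded support, hence an admissible
test function; bounded finiteness makes it integrable, which allows passing to `ℝ≥0∞`. -/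
theorem RealizesPmGH.tendsto_lintegral_thickenedIndicator (h : RealizesPmGH p m q μ R ε ψ)
    (hm : ∀ i, BoundedlyFinite (m i)) (hμ : BoundedlyFinite μ) {C : Set Y}
    (hC : Bornology.IsBounded C) {s : ℝ} (hs : 0 < s) :
    Tendsto (fun i => ∫⁻ x in ball (p i) (R i), thickenedIndicator hs C (ψ i x) ∂(m i)) atTop
      (𝓝 (∫⁻ y, thickenedIndicator hs C y ∂μ)) := by
  have hC' : Bornology.IsBounded (thickening s C) := hC.thickening
  have hsupp : (Function.support fun y => (thickenedIndicator hs C y : ℝ)) ⊆ thickening s C := by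
    intro y hy
    by_contra hy'
    exact hy (by simp [thickenedIndicator_zero hs C hy'])
  have hcont : Continuous fun y => (thickenedIndicator hs C y : ℝ) :=
    NNReal.continuous_coe.comp (thickenedIndicator hs C).continuous
  have hle : ∀ y, ‖(thickenedIndicator hs C y : ℝ)‖ ≤ 1 := fun y => by
    rw [Real.norm_of_nonneg (NNReal.coe_nonneg _)]
    exact_mod_cast thickenedIndicator_le_one hs C y
  have hint : Integrable (fun y => (thickenedIndicator hs C y : ℝ)) μ := by
    rw [← integrableOn_iff_integrable_of_support_subset hsupp]
    have : IsFiniteMeasure (μ.restrict (thickening s C)) :=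
      ⟨by rw [Measure.restrict_apply_univ]; exact hμ.lt_top hC'⟩
    exact Integrable.of_bound hcont.measurable.aestronglyMeasurable 1
      (Eventually.of_forall hle)
  have hinti : ∀ i, Integrable (fun x => (thickenedIndicator hs C (ψ i x) : ℝ))
      ((m i).restrict (ball (p i) (R i))) := fun i => by
    have : IsFiniteMeasure ((m i).restrict (ball (p i) (R i))) :=
      ⟨by rw [Measure.restrict_apply_univ]; exact (hm i).lt_top isBounded_ball⟩
    refine Integrable.of_bound (AEMeasurable.aestronglyMeasurable ?_) 1
      (Eventually.of_forall fun x => hle _)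
    exact aemeasurable_restrict_of_measurable_subtype isOpen_ball.measurableSet
      (hcont.measurable.comp (h.approx i).measurable_on)
  rw [lintegral_coe_eq_integral _ hint]
  simp_rw [fun i => lintegral_coe_eq_integral _ (hinti i)]
  exact ENNReal.tendsto_ofReal (h.weak_conv _ hcont ⟨1, hle⟩
    (hC'.closure.subset (closure_mono hsupp)))

/-- Upper portmanteau inequality: the test function is at least `1` on `C` and lives on the
thickening. -/
theorem RealizesPmGH.eventually_lt_of_measure_thickening_lt (h : RealizesPmGH p m q μ R ε ψ)
    (hm : ∀ i, BoundedlyFinite (m i)) (hμ : BoundedlyFinite μ) {C : Set Y}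
    (hC : Bornology.IsBounded C) (hCm : MeasurableSet C) {s : ℝ} (hs : 0 < s) {c : ℝ≥0∞}
    (hc : μ (thickening s C) < c) :
    ∀ᶠ i in atTop, m i (ball (p i) (R i) ∩ ψ i ⁻¹' C) < c := by
  have hle : ∫⁻ y, thickenedIndicator hs C y ∂μ ≤ μ (thickening s C) := by
    rw [← lintegral_indicator_one isOpen_thickening.measurableSet]
    refine lintegral_mono fun y => ?_
    by_cases hy : y ∈ thickening s C
    · rw [Set.indicator_of_mem hy, Pi.one_apply]
      exact ENNReal.coe_le_one_iff.2 (thickenedIndicator_le_one hs C y)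
    · simp [thickenedIndicator_zero hs C hy]
  filter_upwards [(h.tendsto_lintegral_thickenedIndicator hm hμ hC hs).eventually_lt_const
    (hle.trans_lt hc)] with i hi
  have hmeas := (h.approx i).measurableSet_preimage le_rfl hCm
  refine lt_of_le_of_lt ?_ hi
  rw [← lintegral_indicator isOpen_ball.measurableSet, ← lintegral_indicator_one hmeas]
  refine lintegral_mono fun x => Set.indicator_le (fun x hx => ?_) x
  rw [Set.indicator_of_mem hx.1, thickenedIndicator_one hs C hx.2]
  simp

/-- The lower counterpart, from the same test function. -/
theorem RealizesPmGH.eventually_lt_measure_of_lt (h : RealizesPmGH p m q μ R ε ψ)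
    (hm : ∀ i, BoundedlyFinite (m i)) (hμ : BoundedlyFinite μ) {C : Set Y}
    (hC : Bornology.IsBounded C) (hCm : MeasurableSet C) {s : ℝ} (hs : 0 < s) {c : ℝ≥0∞}
    (hc : c < μ C) :
    ∀ᶠ i in atTop, c < m i (ball (p i) (R i) ∩ ψ i ⁻¹' thickening s C) := by
  have hle : μ C ≤ ∫⁻ y, thickenedIndicator hs C y ∂μ := by
    rw [← lintegral_indicator_one hCm]
    refine lintegral_mono (Set.indicator_le fun y hy => ?_)
    rw [thickenedIndicator_one hs C hy]
    simp
  filter_upwards [(h.tendsto_lintegral_thickenedIndicator hm hμ hC hs).eventually_const_lt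
    (hc.trans_le hle)] with i hi
  have hmeas := (h.approx i).measurableSet_preimage le_rfl
    (isOpen_thickening (δ := s) (E := C)).measurableSet
  refine hi.trans_le ?_
  rw [← lintegral_indicator isOpen_ball.measurableSet, ← lintegral_indicator_one hmeas]
  refine lintegral_mono fun x => Set.indicator_le (fun x hx => ?_) x
  by_cases hy : ψ i x ∈ thickening s C
  · rw [Set.indicator_of_mem (show x ∈ ball (p i) (R i) ∩ ψ i ⁻¹' thickening s C from ⟨hx, hy⟩),
      Pi.one_apply]
    exact ENNReal.coe_le_one_iff.2 (thickenedIndicator_le_one hs C _)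
  · simp [thickenedIndicator_zero hs C hy]

theorem RealizesPmGH.uniformlyBoundedlyFinite (h : RealizesPmGH p m q μ R ε ψ)
    {ω : Ultrafilter ℕ} (hω : (ω : Filter ℕ) ≤ atTop)
    (hm : ∀ i, BoundedlyFinite (m i)) (hμ : BoundedlyFinite μ) :
    UniformlyBoundedlyFinite ω p m := by
  -- Once `ε i < 1`, `ψ i` maps the `r`-ball into `ball q (r + 1)`; the summand `1` gives positivity
  -- and the strict inequality needed for the portmanteau bound.
  refine ⟨fun r => (μ (thickening 1 (ball q (r + 1)))).toReal + 1, fun r _ => by positivity,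
    fun r _ => hω ?_⟩
  have hb : Bornology.IsBounded (ball q (r + 1)) := isBounded_ball
  have hfin : μ (thickening 1 (ball q (r + 1))) ≠ ∞ := (hμ.lt_top hb.thickening).ne
  rw [ENNReal.ofReal_add ENNReal.toReal_nonneg zero_le_one, ENNReal.ofReal_toReal hfin,
    ENNReal.ofReal_one]
  filter_upwards [h.eventually_lt_of_measure_thickening_lt hm hμ hb isOpen_ball.measurableSet
    one_pos (ENNReal.lt_add_right hfin one_ne_zero), h.eventually_radius r 0,
    h.eps_tendsto.eventually_lt_const one_pos] with i hi hR hε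
  refine (measure_mono fun x hx => ?_).trans hi.le
  have hr : r ≤ R i := by linarith
  exact ⟨ball_subset_ball hr hx, mem_ball.2 (by linarith [(h.approx i).dist_base_lt hr hx])⟩

end Weak

/-! ### Isometric images and supports -/

section Isometry

variable {Y : Type*} {W : Type*} [MetricSpace Y] [MetricSpace W]

theorem measurableSet_ballSigma_ball (w : W) (r : ℝ) : MeasurableSet[ballSigma W] (ball w r) :=
  MeasurableSpace.measurableSet_generateFrom ⟨w, r, rfl⟩

/-- By completeness the image is closed, so it is the set of points within `1 / (n + 1)` of a dense
sequence of the image for every `n`. -/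
theorem measurableSet_ballSigma_image_of_isClosed [CompleteSpace Y]
    [TopologicalSpace.SeparableSpace Y] {f : Y → W} (hf : Isometry f) {C : Set Y}
    (hC : IsClosed C) : MeasurableSet[ballSigma W] (f '' C) := by
  let : MeasurableSpace W := ballSigma W
  rcases C.eq_empty_or_nonempty with rfl | hne
  · simp
  have : Nonempty C := hne.to_subtype
  have hcl : IsClosed (f '' C) := hf.isClosedEmbedding.isClosedMap C hC
  have heq : f '' C = ⋂ n : ℕ, ⋃ k : ℕ,
      ball (f (TopologicalSpace.denseSeq C k)) (1 / ((n : ℝ) + 1)) := by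
    apply Set.Subset.antisymm
    · rintro _ ⟨c, hc, rfl⟩
      refine Set.mem_iInter.2 fun n => ?_
      obtain ⟨k, hk⟩ := (TopologicalSpace.denseRange_denseSeq C).exists_dist_lt ⟨c, hc⟩
        (Nat.one_div_pos_of_nat (α := ℝ) (n := n))
      refine Set.mem_iUnion.2 ⟨k, ?_⟩
      rw [mem_ball, hf.dist_eq]
      exact hk
    · intro w hw
      rw [← hcl.closure_eq, Metric.mem_closure_iff]
      intro δ hδ
      obtain ⟨n, hn⟩ := exists_nat_one_div_lt hδ
      obtain ⟨k, hk⟩ := Set.mem_iUnion.1 (Set.mem_iInter.1 hw n)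
      exact ⟨_, ⟨_, (TopologicalSpace.denseSeq C k).2, rfl⟩, (mem_ball.1 hk).trans hn⟩
  rw [heq]
  exact MeasurableSet.iInter fun n => MeasurableSet.iUnion fun k =>
    measurableSet_ballSigma_ball _ _

theorem measurableSet_ballSigma_image [CompleteSpace Y] [TopologicalSpace.SeparableSpace Y]
    [MeasurableSpace Y] [BorelSpace Y] {f : Y → W} (hf : Isometry f) {E : Set Y}
    (hE : MeasurableSet E) : MeasurableSet[ballSigma W] (f '' E) := by
  let : MeasurableSpace W := ballSigma W
  have huniv := measurableSet_ballSigma_image_of_isClosed hf (isClosed_univ (X := Y))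
  rw [BorelSpace.measurable_eq (α := Y), borel_eq_generateFrom_isClosed] at hE
  induction E, hE using MeasurableSpace.generateFrom_induction with
  | hC t ht _ => exact measurableSet_ballSigma_image_of_isClosed hf ht
  | empty => simp
  | compl t _ ih =>
    -- Complements are taken inside the range, which is itself the image of a closed set.
    rw [Set.compl_eq_univ_sdiff, Set.image_sdiff hf.injective]
    exact huniv.diff ih
  | iUnion s _ ih =>
    rw [Set.image_iUnion]
    exact MeasurableSet.iUnion ih

variable [MeasurableSpace Y]

theorem measurable_ballSigma_of_continuous [OpensMeasurableSpace Y] {f : Y → W} (hf : Continuous f) :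
    Measurable[_, ballSigma W] f := by
  refine @measurable_generateFrom _ _ _ _ _ ?_
  rintro _ ⟨w, r, rfl⟩
  exact (isOpen_ball.preimage hf).measurableSet

theorem isClosed_spt (μ : Measure Y) : IsClosed (spt μ) := by
  rw [← isOpen_compl_iff, Metric.isOpen_iff]
  intro y hy
  simp only [spt, Set.mem_compl_iff, Set.mem_ofPred_eq, not_forall, not_lt, nonpos_iff_eq_zero]
    at hy
  obtain ⟨r, hr, h0⟩ := hy
  refine ⟨r / 2, half_pos hr, fun x hx hx' => (hx' (r / 2) (half_pos hr)).ne' ?_⟩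
  refine measure_mono_null (ball_subset_ball' ?_) h0
  linarith [mem_ball.1 hx]

theorem measure_compl_spt [TopologicalSpace.SeparableSpace Y] (μ : Measure Y) :
    μ (spt μ)ᶜ = 0 := by
  have : SecondCountableTopology Y := UniformSpace.secondCountable_of_separable Y
  refine measure_null_of_locally_null _ fun y hy => ?_
  simp only [spt, Set.mem_compl_iff, Set.mem_ofPred_eq, not_forall, not_lt, nonpos_iff_eq_zero]
    at hy
  obtain ⟨r, hr, h0⟩ := hy
  exact ⟨ball y r, mem_nhdsWithin_of_mem_nhds (ball_mem_nhds y hr), h0⟩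

/-- Each ball around a support point is charged, hence meets the range; the range is closed by
completeness, so the point is an image. -/
theorem spt_map_of_isometry [CompleteSpace Y] [MeasurableSpace W]
    (hW : ∀ (w : W) (r : ℝ), MeasurableSet (ball w r)) {f : Y → W} (hf : Isometry f)
    (hfm : Measurable f) (μ : Measure Y) : spt (μ.map f) = f '' spt μ := by
  apply Set.Subset.antisymm
  · intro w hw
    have hcl : IsClosed (Set.range f) := hf.isClosedEmbedding.isClosed_range
    have hmem : w ∈ Set.range f := by
      rw [← hcl.closure_eq, Metric.mem_closure_iff]
      intro r hr
      have h := hw r hr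
      rw [Measure.map_apply hfm (hW w r)] at h
      obtain ⟨y, hy⟩ := nonempty_of_measure_ne_zero h.ne'
      exact ⟨f y, ⟨y, rfl⟩, by simpa [dist_comm] using hy⟩
    obtain ⟨y, rfl⟩ := hmem
    refine ⟨y, fun r hr => ?_, rfl⟩
    have h := hw r hr
    rwa [Measure.map_apply hfm (hW _ r), hf.preimage_ball] at h
  · rintro _ ⟨y, hy, rfl⟩ r hr
    rw [Measure.map_apply hfm (hW _ r), hf.preimage_ball]
    exact hy r hr

/-- Inner regularity of finite measures on Polish spaces, applied to `E` and its complement; finite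
unions make the compact sets increase. -/
theorem exists_monotone_isCompact_pair [CompleteSpace Y] [TopologicalSpace.SeparableSpace Y]
    [BorelSpace Y] (ν : Measure Y) [IsFiniteMeasure ν] {E : Set Y} (hE : MeasurableSet E) :
    ∃ K L : ℕ → Set Y, Monotone K ∧ Monotone L ∧ (∀ n, IsCompact (K n)) ∧
      (∀ n, IsCompact (L n)) ∧ (∀ n, K n ⊆ E) ∧ (∀ n, L n ⊆ Eᶜ) ∧
      ∀ n : ℕ, ν (K n ∪ L n)ᶜ < ((n : ℝ≥0∞) + 1)⁻¹ := by
  have : SecondCountableTopology Y := UniformSpace.secondCountable_of_separable Y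
  have key : ∀ F : Set Y, MeasurableSet F → ∃ K : ℕ → Set Y, Monotone K ∧
      (∀ n, IsCompact (K n)) ∧ (∀ n, K n ⊆ F) ∧ ∀ n : ℕ, ν (F \ K n) < ((n : ℝ≥0∞) + 1)⁻¹ / 2 := by
    intro F hF
    have h : ∀ n : ℕ, ∃ K ⊆ F, IsCompact K ∧ ν (F \ K) < ((n : ℝ≥0∞) + 1)⁻¹ / 2 := fun n =>
      hF.exists_isCompact_sdiff_lt (measure_ne_top ν F) (by simp)
    choose K hKF hK hKn using h
    refine ⟨Set.accumulate K, Set.monotone_accumulate, fun n => ?_, fun n => ?_, fun n => ?_⟩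
    · exact (Set.finite_le_nat n).isCompact_biUnion fun k _ => hK k
    · exact Set.iUnion₂_subset fun k _ => hKF k
    · exact (measure_mono (Set.sdiff_subset_sdiff_right Set.subset_accumulate)).trans_lt (hKn n)
  obtain ⟨K, hKm, hKc, hKE, hKn⟩ := key E hE
  obtain ⟨L, hLm, hLc, hLE, hLn⟩ := key Eᶜ hE.compl
  refine ⟨K, L, hKm, hLm, hKc, hLc, hKE, hLE, fun n => ?_⟩
  have hsub : (K n ∪ L n)ᶜ ⊆ (E \ K n) ∪ (Eᶜ \ L n) := fun y hy => by
    rw [Set.mem_compl_iff, Set.mem_union, not_or] at hy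
    by_cases hyE : y ∈ E
    · exact Or.inl ⟨hyE, hy.1⟩
    · exact Or.inr ⟨hyE, hy.2⟩
  exact ((measure_mono hsub).trans (measure_union_le _ _)).trans_lt
    ((ENNReal.add_lt_add (hKn n) (hLn n)).trans_eq (ENNReal.add_halves _))

end Isometry

/-! ### Diagonal sequences and limits along an ultrafilter -/

theorem exists_tendsto_atTop_eventually {P : ℕ → ℕ → Prop} (h : ∀ k, ∀ᶠ i in atTop, P k i) :
    ∃ κ : ℕ → ℕ, Tendsto κ atTop atTop ∧ ∀ᶠ i in atTop, P (κ i) i := by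
  classical
  have h' : ∀ k, ∃ N, ∀ i ≥ N, P k i := fun k => eventually_atTop.1 (h k)
  choose N hN using h'
  refine ⟨fun i => Nat.findGreatest (fun k => ∀ j ≤ k, N j ≤ i) i, ?_, ?_⟩
  · refine tendsto_atTop.2 fun k => ?_
    have : ∀ᶠ i in atTop, ∀ j ∈ Set.Iic k, N j ≤ i :=
      (Set.finite_Iic k).eventually_all.2 fun j _ => eventually_ge_atTop (N j)
    filter_upwards [this, eventually_ge_atTop k] with i hi hik
    exact Nat.le_findGreatest hik hi
  -- `Nat.findGreatest` returns `0` by default, so the predicate must be known at `0`.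
  · filter_upwards [eventually_ge_atTop (N 0)] with i hi
    have := Nat.findGreatest_spec (P := fun k => ∀ j ≤ k, N j ≤ i) (Nat.zero_le i)
      (fun j hj => by rwa [Nat.le_zero.1 hj])
    exact hN _ i (this _ le_rfl)

/-- Nearby points of `K` converge along the ultrafilter by compactness, without passing to a
subsequence, and drag `y` along. -/
theorem exists_tendsto_of_mem_thickening {Y : Type*} [MetricSpace Y] {ω : Ultrafilter ℕ}
    {K : Set Y} (hK : IsCompact K) {r : ℕ → ℝ} (hr : Tendsto r (ω : Filter ℕ) (𝓝 0)) {y : ℕ → Y}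
    (hy : ∀ᶠ i in (ω : Filter ℕ), y i ∈ thickening (r i) K) :
    ∃ z ∈ K, Tendsto y (ω : Filter ℕ) (𝓝 z) := by
  have h : ∀ i, ∃ z, y i ∈ thickening (r i) K → z ∈ K ∧ dist (y i) z < r i := fun i => by
    by_cases hi : y i ∈ thickening (r i) K
    · obtain ⟨z, hz, hd⟩ := mem_thickening_iff.1 hi
      exact ⟨z, fun _ => ⟨hz, hd⟩⟩
    · exact ⟨y i, fun h => (hi h).elim⟩
  choose z hz using h
  obtain ⟨w, hwK, hw⟩ := hK.ultrafilter_le_nhds (ω.map z)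
    (by
      rw [Ultrafilter.coe_map, le_principal_iff]
      exact hy.mono fun i hi => (hz i hi).1)
  refine ⟨w, hwK, ?_⟩
  have hw' : Tendsto z (ω : Filter ℕ) (𝓝 w) := hw
  have hd : Tendsto (fun i => dist (z i) (y i)) (ω : Filter ℕ) (𝓝 0) :=
    squeeze_zero' (Eventually.of_forall fun _ => dist_nonneg)
      (hy.mono fun i hi => by rw [dist_comm]; exact (hz i hi).2.le) hr
  exact (tendsto_iff_of_dist hd).1 hw'

/-! ### The limit map -/

theorem limitMap_of_mem {ω : Ultrafilter ℕ} {X : ℕ → Type u} [∀ i, MetricSpace (X i)]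
    {p : ∀ i, X i} {Y : Type v} {φ : ∀ i, Y → X i} {y : Y}
    (hy : Ultraprod.mk ω (fun i => φ i y) ∈ finiteSet ω p) :
    limitMap ω p φ y = proj ω p ⟨Ultraprod.mk ω (fun i => φ i y), hy⟩ :=
  dif_pos hy

section LimitMap

variable {ω : Ultrafilter ℕ} {X : ℕ → Type u} [∀ i, MetricSpace (X i)]
  [∀ i, MeasurableSpace (X i)] {Y : Type v} [MetricSpace Y] [MeasurableSpace Y]
  {p : ∀ i, X i} {m : ∀ i, Measure (X i)} {q : Y} {μ : Measure Y}
  {R ε : ℕ → ℝ} {ψ : ∀ i, X i → Y} {φ : ∀ i, Y → X i}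

theorem RealizesPmGH.eventually_isQuasiInverse (h : RealizesPmGH p m q μ R ε ψ)
    (hφ : ∀ i, 4 * ε i < R i → IsQuasiInverse (R i) (ε i) (p i) q (ψ i) (φ i)) :
    ∀ᶠ i in atTop, IsQuasiInverse (R i) (ε i) (p i) q (ψ i) (φ i) := by
  filter_upwards [h.eventually_radius 0 4] with i hi
  exact hφ i (by linarith)

theorem RealizesPmGH.eventually_mem_ball (h : RealizesPmGH p m q μ R ε ψ) (y : Y) (k : ℝ) :
    ∀ᶠ i in atTop, y ∈ ball q (R i - k * ε i) := by
  filter_upwards [h.eventually_radius (dist y q) k] with i hi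
  exact mem_ball.2 (by linarith)

theorem RealizesPmGH.eventually_quasiInverse_mem_ball (h : RealizesPmGH p m q μ R ε ψ)
    (hφ : ∀ i, 4 * ε i < R i → IsQuasiInverse (R i) (ε i) (p i) q (ψ i) (φ i)) (y : Y) :
    ∀ᶠ i in atTop, φ i y ∈ ball (p i) (dist y q + 4) := by
  filter_upwards [h.eventually_isQuasiInverse hφ, h.eventually_radius (dist y q + 1) 1,
    h.eps_tendsto.eventually_lt_const one_pos] with i hi hR hε
  -- The `4` in the claim is `1` for this radius plus the distortion `3 * ε i < 3`.
  have := hi.approx.dist_base_lt (x := y) (r := dist y q + 1) (by linarith)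
    (mem_ball.2 (lt_add_one _))
  exact mem_ball.2 (by linarith)

theorem RealizesPmGH.mk_mem_finiteSet (h : RealizesPmGH p m q μ R ε ψ)
    (hω : (ω : Filter ℕ) ≤ atTop)
    (hφ : ∀ i, 4 * ε i < R i → IsQuasiInverse (R i) (ε i) (p i) q (ψ i) (φ i)) (y : Y) :
    Ultraprod.mk ω (fun i => φ i y) ∈ finiteSet ω p :=
  mem_finiteSet_of_eventually (hω (h.eventually_quasiInverse_mem_ball hφ y))

theorem RealizesPmGH.tendsto_three_eps (h : RealizesPmGH p m q μ R ε ψ)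
    (hω : (ω : Filter ℕ) ≤ atTop) : Tendsto (fun i => 3 * ε i) (ω : Filter ℕ) (𝓝 0) := by
  simpa using (h.eps_tendsto.mono_left hω).const_mul 3

theorem RealizesPmGH.isometry_limitMap (h : RealizesPmGH p m q μ R ε ψ)
    (hω : (ω : Filter ℕ) ≤ atTop)
    (hφ : ∀ i, 4 * ε i < R i → IsQuasiInverse (R i) (ε i) (p i) q (ψ i) (φ i)) :
    Isometry (limitMap ω p φ) := by
  intro x y
  rw [limitMap_of_mem (h.mk_mem_finiteSet hω hφ x), limitMap_of_mem (h.mk_mem_finiteSet hω hφ y),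
    edist_proj_mk]
  apply Ultraprod.edist_eq_of_tendsto
  simp only [edist_dist]
  refine ENNReal.tendsto_ofReal (tendsto_iff_dist_tendsto_zero.2 ?_)
  refine squeeze_zero' (Eventually.of_forall fun _ => dist_nonneg) (hω ?_)
    (h.tendsto_three_eps hω)
  filter_upwards [h.eventually_isQuasiInverse hφ, h.eventually_mem_ball x 1,
    h.eventually_mem_ball y 1] with i hi hx hy
  rw [one_mul] at hx hy
  rw [dist_comm, Real.dist_eq]
  exact hi.approx.dist_le x hx y hy

theorem RealizesPmGH.limitMap_base (h : RealizesPmGH p m q μ R ε ψ)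
    (hω : (ω : Filter ℕ) ≤ atTop)
    (hφ : ∀ i, 4 * ε i < R i → IsQuasiInverse (R i) (ε i) (p i) q (ψ i) (φ i)) :
    limitMap ω p φ q = basePoint ω p := by
  rw [limitMap_of_mem (h.mk_mem_finiteSet hω hφ q)]
  refine proj_mk_eq_of_tendsto _ _ (tendsto_const_nhds.congr' (hω ?_))
  filter_upwards [h.eventually_isQuasiInverse hφ] with i hi
  rw [hi.approx.base, dist_self]

/-- As `ψ i` almost preserves distances, `a i` and `φ i y` are asymptotically equal when their
images are; both images tend to `y`. This identifies which points of the ultralimit come from the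
limit space. -/
theorem RealizesPmGH.proj_eq_limitMap (h : RealizesPmGH p m q μ R ε ψ)
    (hω : (ω : Filter ℕ) ≤ atTop)
    (hφ : ∀ i, 4 * ε i < R i → IsQuasiInverse (R i) (ε i) (p i) q (ψ i) (φ i))
    {a : ∀ i, X i} (ha : Ultraprod.mk ω a ∈ finiteSet ω p)
    (haR : ∀ᶠ i in (ω : Filter ℕ), a i ∈ ball (p i) (R i)) {y : Y}
    (hy : Tendsto (fun i => ψ i (a i)) (ω : Filter ℕ) (𝓝 y)) :
    proj ω p ⟨Ultraprod.mk ω a, ha⟩ = limitMap ω p φ y := by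
  rw [limitMap_of_mem (h.mk_mem_finiteSet hω hφ y)]
  refine proj_mk_eq_of_tendsto _ _ ?_
  have hlim : Tendsto (fun i => dist (ψ i (a i)) y + 3 * ε i + ε i) (ω : Filter ℕ) (𝓝 0) := by
    simpa using ((tendsto_iff_dist_tendsto_zero.1 hy).add (h.tendsto_three_eps hω)).add
      (h.eps_tendsto.mono_left hω)
  refine squeeze_zero' (Eventually.of_forall fun _ => dist_nonneg) ?_ hlim
  filter_upwards [haR, hω (h.eventually_isQuasiInverse hφ), hω (h.eventually_mem_ball y 1),
    hω (h.eventually_quasiInverse_mem_ball hφ y),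
    hω (h.eventually_radius (dist y q + 4) 0)] with i hai hi hyi hφi hRi
  rw [one_mul] at hyi
  have h1 := abs_le.1 ((h.approx i).dist_le _ hai _ (ball_subset_ball (by linarith) hφi))
  have h2 := hi.right_inv y hyi
  linarith [dist_triangle (ψ i (a i)) y (ψ i (φ i y))]

theorem RealizesPmGH.measurable_limitMap [OpensMeasurableSpace Y]
    (h : RealizesPmGH p m q μ R ε ψ)
    (hω : (ω : Filter ℕ) ≤ atTop)
    (hφ : ∀ i, 4 * ε i < R i → IsQuasiInverse (R i) (ε i) (p i) q (ψ i) (φ i)) :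
    Measurable (limitMap ω p φ) :=
  measurable_ballSigma_of_continuous (h.isometry_limitMap hω hφ).continuous

theorem RealizesPmGH.exists_quasiInverses [TopologicalSpace.SeparableSpace Y]
    [OpensMeasurableSpace Y] (h : RealizesPmGH p m q μ R ε ψ) :
    ∃ φ : ∀ i, Y → X i, ∀ i, 4 * ε i < R i →
      IsQuasiInverse (R i) (ε i) (p i) q (ψ i) (φ i) := by
  have hex : ∀ i, ∃ f : Y → X i, 4 * ε i < R i →
      IsQuasiInverse (R i) (ε i) (p i) q (ψ i) f := fun i => by
    by_cases hi : 4 * ε i < R i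
    · obtain ⟨f, hf⟩ := (h.approx i).exists_isQuasiInverse hi
      exact ⟨f, fun _ => hf⟩
    · exact ⟨fun _ => p i, fun h => (hi h).elim⟩
  choose φ hφ using hex
  exact ⟨φ, hφ⟩

end LimitMap

/-! ### Internal approximations of preimages -/

section TestPair

variable {X : ℕ → Type u} [∀ i, MetricSpace (X i)] [∀ i, MeasurableSpace (X i)]
  {Y : Type v} [MetricSpace Y] [MeasurableSpace Y]

/-- The points of the ball of radius `r` that `ψ i` maps close to `K (κ i)`. -/
def nearSet (p : ∀ i, X i) (R : ℕ → ℝ) (ψ : ∀ i, X i → Y) (r : ℝ) (K : ℕ → Set Y) (κ : ℕ → ℕ)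
    (t : ℕ → ℝ) (i : ℕ) : Set (X i) :=
  ball (p i) (min r (R i)) ∩ ψ i ⁻¹' thickening (t i) (K (κ i))

/-- The points of the ball of radius `r` that `ψ i` maps far from `C`. -/
def farSet (p : ∀ i, X i) (R : ℕ → ℝ) (ψ : ∀ i, X i → Y) (r : ℝ) (C : Set Y) (t : ℕ → ℝ)
    (i : ℕ) : Set (X i) :=
  ball (p i) (min r (R i)) ∩ ψ i ⁻¹' (thickening (t i) C)ᶜ

/-- Increasing compact subsets `K n` of `E` and `L n` of its complement which asymptotically fill
the ball of radius `r + 2`, separated along a sequence of scales `t` at which the preimages under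
`ψ` still have almost full measure. -/
structure IsTestPair (p : ∀ i, X i) (m : ∀ i, Measure (X i)) (q : Y) (μ : Measure Y) (R : ℕ → ℝ)
    (ψ : ∀ i, X i → Y) (E : Set Y) (r : ℝ) (K L : ℕ → Set Y) (κ : ℕ → ℕ) (t : ℕ → ℝ) : Prop where
  mono_left : Monotone K
  mono_right : Monotone L
  compact_left : ∀ n, IsCompact (K n)
  compact_right : ∀ n, IsCompact (L n)
  subset_left : ∀ n, K n ⊆ E
  subset_right : ∀ n, L n ⊆ Eᶜ
  measure_le : ∀ n : ℕ, μ ((K n ∪ L n)ᶜ ∩ ball q (r + 2)) ≤ ((n : ℝ≥0∞) + 1)⁻¹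
  index_tendsto : Tendsto κ atTop atTop
  scale_tendsto : Tendsto t atTop (𝓝 0)
  disjoint : ∀ i, Disjoint (thickening (t i) (K (κ i))) (thickening (t i) (L (κ i)))
  far_le : ∀ n : ℕ, ∀ᶠ i in atTop,
    m i (farSet p R ψ r (K n ∪ L n) t i) ≤ ((n : ℝ≥0∞) + 1)⁻¹

variable {p : ∀ i, X i} {m : ∀ i, Measure (X i)} {q : Y} {μ : Measure Y}
  {R ε : ℕ → ℝ} {ψ : ∀ i, X i → Y} [∀ i, BorelSpace (X i)] [BorelSpace Y]

/-- Far points land in `ball q (r + 1)` minus a thickening of `C`. Thickening this region by at most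
`min s 1` still avoids `C` and stays in `ball q (r + 2)`, so the upper portmanteau inequality
applies. -/
theorem RealizesPmGH.eventually_farSet_lt (h : RealizesPmGH p m q μ R ε ψ)
    (hm : ∀ i, BoundedlyFinite (m i)) (hμ : BoundedlyFinite μ) {C : Set Y} {r s : ℝ} (hs : 0 < s)
    {c : ℝ≥0∞} (hc : μ (Cᶜ ∩ ball q (r + 2)) < c) :
    ∀ᶠ i in atTop, m i (farSet p R ψ r C (fun _ => s) i) < c := by
  have hD : Bornology.IsBounded (ball q (r + 1) ∩ (thickening s C)ᶜ) :=
    isBounded_ball.subset Set.inter_subset_left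
  have hsub : thickening (min s 1) (ball q (r + 1) ∩ (thickening s C)ᶜ) ⊆ Cᶜ ∩ ball q (r + 2) := by
    intro y hy
    obtain ⟨z, ⟨hzq, hzC⟩, hyz⟩ := mem_thickening_iff.1 hy
    refine ⟨fun hyC => hzC (mem_thickening_iff.2 ⟨y, hyC, ?_⟩), mem_ball.2 ?_⟩
    · rw [dist_comm]
      exact hyz.trans_le (min_le_left _ _)
    · linarith [dist_triangle y z q, mem_ball.1 hzq, hyz.trans_le (min_le_right s 1)]
  filter_upwards [h.eventually_lt_of_measure_thickening_lt hm hμ hD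
    (isOpen_ball.measurableSet.inter isOpen_thickening.measurableSet.compl)
    (lt_min hs one_pos) ((measure_mono hsub).trans_lt hc),
    h.eps_tendsto.eventually_lt_const one_pos, h.eventually_radius r 0] with i hi hε hR
  refine (measure_mono ?_).trans_lt hi
  rintro x ⟨hx, hxC⟩
  have hx' : x ∈ ball (p i) r := ball_subset_ball (min_le_left _ _) hx
  refine ⟨ball_subset_ball (min_le_right _ _) hx, mem_ball.2 ?_, hxC⟩
  linarith [(h.approx i).dist_base_lt (by linarith) hx']

theorem RealizesPmGH.exists_isTestPair [CompleteSpace Y] [TopologicalSpace.SeparableSpace Y]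
    (h : RealizesPmGH p m q μ R ε ψ) (hm : ∀ i, BoundedlyFinite (m i)) (hμ : BoundedlyFinite μ)
    {E : Set Y} (hE : MeasurableSet E) (r : ℝ) :
    ∃ K L κ t, IsTestPair p m q μ R ψ E r K L κ t := by
  have : IsFiniteMeasure (μ.restrict (ball q (r + 2))) :=
    ⟨by rw [Measure.restrict_apply_univ]; exact hμ.lt_top isBounded_ball⟩
  obtain ⟨K, L, hK, hL, hKc, hLc, hKE, hLE, hKL⟩ :=
    exists_monotone_isCompact_pair (μ.restrict (ball q (r + 2))) hE
  have hKL' : ∀ n : ℕ, μ ((K n ∪ L n)ᶜ ∩ ball q (r + 2)) < ((n : ℝ≥0∞) + 1)⁻¹ := fun n => by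
    rw [← Measure.restrict_apply' isOpen_ball.measurableSet]
    exact hKL n
  have hs : ∀ k : ℕ, ∃ s : ℝ, 0 < s ∧ s ≤ 1 / ((k : ℝ) + 1) ∧
      Disjoint (thickening s (K k)) (thickening s (L k)) := fun k => by
    obtain ⟨s, hs, hd⟩ := ((disjoint_compl_right (a := E)).mono (hKE k)
      (hLE k)).exists_thickenings (hKc k) (hLc k).isClosed
    exact ⟨min s (1 / ((k : ℝ) + 1)), lt_min hs Nat.one_div_pos_of_nat, min_le_right _ _,
      hd.mono (thickening_mono (min_le_left _ _) _) (thickening_mono (min_le_left _ _) _)⟩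
  choose s hs0 hs1 hsd using hs
  -- Diagonal choice: at index `i` the scale `s (κ i)` is still coarse enough for the far sets of
  -- all `n ≤ κ i` to be small simultaneously.
  obtain ⟨κ, hκ, hP⟩ := exists_tendsto_atTop_eventually
    (P := fun k i => ∀ n ∈ Set.Iic k,
      m i (farSet p R ψ r (K n ∪ L n) (fun _ => s k) i) < ((n : ℝ≥0∞) + 1)⁻¹)
    (fun k => (Set.finite_Iic k).eventually_all.2 fun n _ =>
      h.eventually_farSet_lt hm hμ (hs0 k) (hKL' n))
  refine ⟨K, L, κ, fun i => s (κ i), hK, hL, hKc, hLc, hKE, hLE, fun n => (hKL' n).le, hκ, ?_,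
    fun i => hsd (κ i), fun n => ?_⟩
  · exact (squeeze_zero (fun k => (hs0 k).le) hs1 tendsto_one_div_add_atTop_nhds_zero_nat).comp hκ
  · filter_upwards [hP, hκ.eventually_ge_atTop n] with i hi hn
    exact (hi n hn).le

variable {E : Set Y} {r : ℝ} {K L : ℕ → Set Y} {κ : ℕ → ℕ} {t : ℕ → ℝ} {ω : Ultrafilter ℕ}

theorem RealizesPmGH.measurableSet_nearSet (h : RealizesPmGH p m q μ R ε ψ) (i : ℕ) :
    MeasurableSet (nearSet p R ψ r K κ t i) :=
  (h.approx i).measurableSet_preimage (min_le_right _ _) isOpen_thickening.measurableSet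

theorem RealizesPmGH.measurableSet_farSet (h : RealizesPmGH p m q μ R ε ψ) {C : Set Y} (i : ℕ) :
    MeasurableSet (farSet p R ψ r C t i) :=
  (h.approx i).measurableSet_preimage (min_le_right _ _) isOpen_thickening.measurableSet.compl

/-- A near point outside the far set of level `n` must map close to `K n`: closeness to `L n` is
excluded by the disjoint thickenings at level `κ i ≥ n`. The thickenings of the compact `K n` shrink
in measure to `μ (K n) ≤ μ E`. -/
theorem IsTestPair.preMeasure_nearSet_le (hT : IsTestPair p m q μ R ψ E r K L κ t)
    (h : RealizesPmGH p m q μ R ε ψ) (hω : (ω : Filter ℕ) ≤ atTop)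
    (hm : ∀ i, BoundedlyFinite (m i)) (hμ : BoundedlyFinite μ) :
    preMeasure ω p m (nearSet p R ψ r K κ t) ≤ μ E := by
  refine ENNReal.le_of_forall_pos_le_add fun δ hδ _ => ?_
  have hδ0 : (δ : ℝ≥0∞) / 2 ≠ 0 := (ENNReal.half_pos (by simpa using hδ.ne')).ne'
  obtain ⟨n, hn⟩ := ENNReal.exists_inv_nat_lt hδ0
  have hn' : ((n : ℝ≥0∞) + 1)⁻¹ ≤ δ / 2 :=
    (ENNReal.inv_le_inv.2 le_self_add).trans hn.le
  have hKb := (hT.compact_left n).isBounded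
  have hlt : μ (K n) < μ (K n) + δ / 2 := ENNReal.lt_add_right (hμ.lt_top hKb).ne hδ0
  obtain ⟨s, hs, hs0⟩ := (((tendsto_measure_thickening_of_isClosed
    ⟨1, one_pos, (hμ.lt_top hKb.thickening).ne⟩
    (hT.compact_left n).isClosed).eventually_lt_const hlt).and self_mem_nhdsWithin).exists
  -- Half of `s` absorbs the scale `t i`, the other half is the loss in the portmanteau inequality.
  have hs2 : 0 < s / 2 := half_pos hs0
  have hlt' : μ (thickening (s / 2) (thickening (s / 2) (K n))) < μ (K n) + δ / 2 := by
    refine (measure_mono ?_).trans_lt hs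
    exact (thickening_thickening_subset _ _ _).trans (by rw [add_halves])
  refine preMeasure_le_of_eventually (hω ?_)
  filter_upwards [h.eventually_lt_of_measure_thickening_lt hm hμ hKb.thickening
    isOpen_thickening.measurableSet hs2 hlt', hT.far_le n,
    hT.scale_tendsto.eventually_lt_const hs2, hT.index_tendsto.eventually_ge_atTop n]
    with i hi hfar hti hκ
  have hsub : nearSet p R ψ r K κ t i ⊆ farSet p R ψ r (K n ∪ L n) t i ∪
      (ball (p i) (R i) ∩ ψ i ⁻¹' thickening (s / 2) (K n)) := by
    rintro x ⟨hx, hxK⟩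
    by_cases hxf : ψ i x ∈ thickening (t i) (K n ∪ L n)
    · rw [thickening_union] at hxf
      rcases hxf with hxf | hxf
      · exact Or.inr ⟨ball_subset_ball (min_le_right _ _) hx, thickening_mono hti.le _ hxf⟩
      · exact (Set.disjoint_left.1 (hT.disjoint i) hxK
          (thickening_subset_of_subset _ (hT.mono_right hκ) hxf)).elim
    · exact Or.inl ⟨hx, hxf⟩
  calc m i (nearSet p R ψ r K κ t i)
      ≤ δ / 2 + (μ (K n) + δ / 2) :=
        (measure_mono hsub).trans ((measure_union_le _ _).trans
          (add_le_add (hfar.trans hn') hi.le))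
    _ = μ (K n) + δ := by rw [add_left_comm, ENNReal.add_halves]
    _ ≤ μ E + δ := by gcongr; exact hT.subset_left n

/-- Points mapping near `K n ∩ ball q (r - 2)` lie in the `r`-ball, because `r - 2 + 1 + ε i < r`,
and are near points unless they are far from `K n ∪ L n`. -/
theorem IsTestPair.le_preMeasure_nearSet (hT : IsTestPair p m q μ R ψ E r K L κ t)
    (h : RealizesPmGH p m q μ R ε ψ) (hω : (ω : Filter ℕ) ≤ atTop)
    (hm : ∀ i, BoundedlyFinite (m i)) (hμ : BoundedlyFinite μ) :
    μ (E ∩ ball q (r - 2)) ≤ preMeasure ω p m (nearSet p R ψ r K κ t) := by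
  refine ENNReal.le_of_forall_pos_le_add fun δ hδ _ => ?_
  have hδ0 : (δ : ℝ≥0∞) / 2 ≠ 0 := (ENNReal.half_pos (by simpa using hδ.ne')).ne'
  obtain ⟨n, hn⟩ := ENNReal.exists_inv_nat_lt hδ0
  have hn' : ((n : ℝ≥0∞) + 1)⁻¹ ≤ δ / 2 :=
    (ENNReal.inv_le_inv.2 le_self_add).trans hn.le
  have hsubE : E ∩ ball q (r - 2) ⊆
      (K n ∩ ball q (r - 2)) ∪ ((K n ∪ L n)ᶜ ∩ ball q (r + 2)) := by
    rintro y ⟨hyE, hyq⟩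
    by_cases hyK : y ∈ K n
    · exact Or.inl ⟨hyK, hyq⟩
    · refine Or.inr ⟨fun hy => hy.elim hyK fun hyL => hT.subset_right n hyL hyE, ?_⟩
      exact ball_subset_ball (by linarith) hyq
  suffices hmain : μ (K n ∩ ball q (r - 2)) ≤
      preMeasure ω p m (nearSet p R ψ r K κ t) + δ / 2 by
    calc μ (E ∩ ball q (r - 2))
        ≤ (preMeasure ω p m (nearSet p R ψ r K κ t) + δ / 2) + δ / 2 :=
          (measure_mono hsubE).trans ((measure_union_le _ _).trans
            (add_le_add hmain ((hT.measure_le n).trans hn')))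
      _ = preMeasure ω p m (nearSet p R ψ r K κ t) + δ := by rw [add_assoc, ENNReal.add_halves]
  refine le_of_forall_lt_imp_le_of_dense fun c hc => ?_
  -- The portmanteau bound only gives closeness to `K n` at a fixed scale, so a fixed separation of
  -- `K n` from `L n` is needed here; the one at scale `t i` would not suffice.
  obtain ⟨s, hs, hd⟩ := ((disjoint_compl_right (a := E)).mono (hT.subset_left n)
    (hT.subset_right n)).exists_thickenings (hT.compact_left n) (hT.compact_right n).isClosed
  have hC : Bornology.IsBounded (K n ∩ ball q (r - 2)) :=
    isBounded_ball.subset Set.inter_subset_right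
  rw [← tsub_le_iff_right]
  refine le_preMeasure_of_eventually r (hω ?_)
  filter_upwards [h.eventually_lt_measure_of_lt hm hμ hC
    ((hT.compact_left n).isClosed.measurableSet.inter isOpen_ball.measurableSet)
    (lt_min hs one_pos) hc, hT.far_le n, hT.scale_tendsto.eventually_lt_const hs,
    hT.index_tendsto.eventually_ge_atTop n, h.eps_tendsto.eventually_lt_const one_pos]
    with i hi hfar hti hκ hε
  have hsub : ball (p i) (R i) ∩ ψ i ⁻¹' thickening (min s 1) (K n ∩ ball q (r - 2)) ⊆
      (nearSet p R ψ r K κ t i ∩ ball (p i) r) ∪ farSet p R ψ r (K n ∪ L n) t i := by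
    rintro x ⟨hx, hxC⟩
    obtain ⟨z, ⟨hzK, hzq⟩, hxz⟩ := mem_thickening_iff.1 hxC
    have hxs : ψ i x ∈ thickening s (K n) :=
      mem_thickening_iff.2 ⟨z, hzK, hxz.trans_le (min_le_left _ _)⟩
    have hxr : x ∈ ball (p i) r := by
      have h1 := abs_le.1 ((h.approx i).dist_le x hx (p i)
        (mem_ball_self (dist_nonneg.trans_lt hx)))
      rw [(h.approx i).base] at h1
      refine mem_ball.2 ?_
      linarith [dist_triangle (ψ i x) z q, mem_ball.1 hzq, hxz.trans_le (min_le_right s 1)]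
    have hxm : x ∈ ball (p i) (min r (R i)) := mem_ball.2 (lt_min hxr hx)
    by_cases hxf : ψ i x ∈ thickening (t i) (K n ∪ L n)
    · rw [thickening_union] at hxf
      rcases hxf with hxf | hxf
      · exact Or.inl ⟨⟨hxm, thickening_subset_of_subset _ (hT.mono_left hκ) hxf⟩, hxr⟩
      · exact (Set.disjoint_left.1 hd hxs (thickening_mono hti.le _ hxf)).elim
    · exact Or.inr ⟨hxm, hxf⟩
  rw [tsub_le_iff_right]
  exact hi.le.trans ((measure_mono hsub).trans ((measure_union_le _ _).trans
    (add_le_add le_rfl (hfar.trans hn'))))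

/-- The error lies in the far set of every level `n`. Elsewhere `ψ i (a i)` converges to a point of
`K n` or of `L n`, which settles membership in `B` and in the near set consistently. -/
theorem IsTestPair.isInternalApprox (hT : IsTestPair p m q μ R ψ E r K L κ t)
    (h : RealizesPmGH p m q μ R ε ψ) (hω : (ω : Filter ℕ) ≤ atTop) {φ : ∀ i, Y → X i}
    (hφ : ∀ i, 4 * ε i < R i → IsQuasiInverse (R i) (ε i) (p i) q (ψ i) (φ i))
    {B : Set (Ultralimit ω p)} (hB : limitMap ω p φ ⁻¹' B = E) :
    IsInternalApprox ω p m (proj ω p ⁻¹' B) r (nearSet p R ψ r K κ t) := by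
  refine ⟨h.measurableSet_nearSet, fun δ hδ => ?_⟩
  obtain ⟨n, hn⟩ := ENNReal.exists_inv_nat_lt hδ.ne'
  have hn' : ((n : ℝ≥0∞) + 1)⁻¹ < δ := (ENNReal.inv_le_inv.2 le_self_add).trans_lt hn
  refine ⟨farSet p R ψ r (K n ∪ L n) t, h.measurableSet_farSet, ?_,
    (preMeasure_le_of_eventually (hω (hT.far_le n))).trans_lt hn'⟩
  intro x hx
  by_contra hfar
  obtain ⟨a, ha, rfl⟩ := FinitePart.exists_rep x
  replace hfar : ∀ᶠ i in (ω : Filter ℕ), a i ∉ farSet p R ψ r (K n ∪ L n) t i :=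
    Ultrafilter.eventually_not.2 fun hcon => hfar ((mem_internal_mk ha).2 hcon)
  have ht : Tendsto t (ω : Filter ℕ) (𝓝 0) := hT.scale_tendsto.mono_left hω
  have hball : ∀ᶠ i in (ω : Filter ℕ), a i ∈ ball (p i) (min r (R i)) := by
    rcases hx with ⟨hx, -⟩ | ⟨hx, -⟩
    · filter_upwards [(mem_internal_mk ha).1 hx.2, hω (h.eventually_radius r 0)] with i hi hR
      exact mem_ball.2 (lt_min hi (hi.trans (by linarith)))
    · exact ((mem_internal_mk ha).1 hx).mono fun i hi => hi.1
  have hballr : (⟨Ultraprod.mk ω a, ha⟩ : FinitePart ω p) ∈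
      internal ω p fun i => ball (p i) r :=
    (mem_internal_mk ha).2 (hball.mono fun i hi => ball_subset_ball (min_le_left _ _) hi)
  have hballR : ∀ᶠ i in (ω : Filter ℕ), a i ∈ ball (p i) (R i) :=
    hball.mono fun i hi => ball_subset_ball (min_le_right _ _) hi
  have hnear : ∀ᶠ i in (ω : Filter ℕ),
      ψ i (a i) ∈ thickening (t i) (K n) ∨ ψ i (a i) ∈ thickening (t i) (L n) := by
    filter_upwards [hfar, hball] with i hi hbi
    rw [← Set.mem_union, ← thickening_union]
    by_contra hcon
    exact hi ⟨hbi, hcon⟩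
  have hκ : ∀ᶠ i in (ω : Filter ℕ), n ≤ κ i := hω (hT.index_tendsto.eventually_ge_atTop n)
  -- The ultrafilter selects one of the two compact sets for almost all indices.
  rcases Ultrafilter.eventually_or.1 hnear with hK | hL
  · obtain ⟨y, hyK, hy⟩ := exists_tendsto_of_mem_thickening (hT.compact_left n) ht hK
    have hmem : (⟨Ultraprod.mk ω a, ha⟩ : FinitePart ω p) ∈ proj ω p ⁻¹' B := by
      change proj ω p ⟨Ultraprod.mk ω a, ha⟩ ∈ B
      rw [h.proj_eq_limitMap hω hφ ha hballR hy, ← Set.mem_preimage, hB]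
      exact hT.subset_left n hyK
    have hmem' : (⟨Ultraprod.mk ω a, ha⟩ : FinitePart ω p) ∈
        internal ω p (nearSet p R ψ r K κ t) := by
      refine (mem_internal_mk ha).2 ?_
      filter_upwards [hball, hK, hκ] with i hi hKi hκi
      exact ⟨hi, thickening_subset_of_subset _ (hT.mono_left hκi) hKi⟩
    rcases hx with ⟨-, hx⟩ | ⟨-, hx⟩
    · exact hx hmem'
    · exact hx ⟨hmem, hballr⟩
  · obtain ⟨y, hyL, hy⟩ := exists_tendsto_of_mem_thickening (hT.compact_right n) ht hL
    have hmem : (⟨Ultraprod.mk ω a, ha⟩ : FinitePart ω p) ∉ proj ω p ⁻¹' B := by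
      change proj ω p ⟨Ultraprod.mk ω a, ha⟩ ∉ B
      rw [h.proj_eq_limitMap hω hφ ha hballR hy, ← Set.mem_preimage, hB]
      exact hT.subset_right n hyL
    rcases hx with ⟨hx, -⟩ | ⟨hx, -⟩
    · exact hmem hx.1
    · obtain ⟨i, hi, hLi, hκi⟩ := (((mem_internal_mk ha).1 hx).and (hL.and hκ)).exists
      exact Set.disjoint_left.1 (hT.disjoint i) hi.2
        (thickening_subset_of_subset _ (hT.mono_right hκi) hLi)

end TestPair

/-! ### The ultralimit measure -/

theorem ultralimitMeasure_apply {ω : Ultrafilter ℕ} {X : ℕ → Type u} [∀ i, MetricSpace (X i)]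
    [∀ i, MeasurableSpace (X i)] {p : ∀ i, X i} {m : ∀ i, Measure (X i)}
    (h : PushforwardIsMeasure ω p m) {B : Set (Ultralimit ω p)} (hB : MeasurableSet B) :
    ultralimitMeasure ω p m B = barMeasure ω p m (proj ω p ⁻¹' B) := by
  rw [ultralimitMeasure, dif_pos h, Measure.ofMeasurable_apply B hB]

section UltralimitMeasure

variable {ω : Ultrafilter ℕ} {X : ℕ → Type u} [∀ i, MetricSpace (X i)]
  [∀ i, MeasurableSpace (X i)] [∀ i, BorelSpace (X i)]
  {Y : Type v} [MetricSpace Y] [MeasurableSpace Y] [BorelSpace Y] [CompleteSpace Y]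
  [TopologicalSpace.SeparableSpace Y]
  {p : ∀ i, X i} {m : ∀ i, Measure (X i)} {q : Y} {μ : Measure Y}
  {R ε : ℕ → ℝ} {ψ : ∀ i, X i → Y} {φ : ∀ i, Y → X i}

theorem RealizesPmGH.barSigma_and_barMeasure (h : RealizesPmGH p m q μ R ε ψ)
    (hω : (ω : Filter ℕ) ≤ atTop) (hm : ∀ i, BoundedlyFinite (m i)) (hμ : BoundedlyFinite μ)
    (hφ : ∀ i, 4 * ε i < R i → IsQuasiInverse (R i) (ε i) (p i) q (ψ i) (φ i))
    {B : Set (Ultralimit ω p)} (hB : MeasurableSet (limitMap ω p φ ⁻¹' B)) :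
    proj ω p ⁻¹' B ∈ barSigma ω p m ∧
      barMeasure ω p m (proj ω p ⁻¹' B) = μ (limitMap ω p φ ⁻¹' B) := by
  choose K L κ t hT using fun r : ℝ => h.exists_isTestPair hm hμ hB r
  have hA : ∀ r, IsInternalApprox ω p m (proj ω p ⁻¹' B) r (nearSet p R ψ r (K r) (κ r) (t r)) :=
    fun r => (hT r).isInternalApprox h hω hφ rfl
  refine ⟨fun r _ => ⟨_, hA r⟩, barMeasure_eq_of_tendsto (fun r _ => hA r) ?_⟩
  -- The lower bounds `μ(E ∩ B(q, r - 2))` increase to the constant upper bound `μ(E)`.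
  refine tendsto_of_tendsto_of_tendsto_of_le_of_le ?_ tendsto_const_nhds
    (fun r => (hT r).le_preMeasure_nearSet h hω hm hμ)
    (fun r => (hT r).preMeasure_nearSet_le h hω hm hμ)
  have hmono : Monotone fun r : ℝ => limitMap ω p φ ⁻¹' B ∩ ball q (r - 2) := fun r s hrs =>
    Set.inter_subset_inter_right _ (ball_subset_ball (by linarith))
  have hU : ⋃ r : ℝ, limitMap ω p φ ⁻¹' B ∩ ball q (r - 2) = limitMap ω p φ ⁻¹' B := by
    rw [← Set.inter_iUnion]
    refine Set.inter_eq_left.2 fun y _ => Set.mem_iUnion.2 ⟨dist y q + 3, mem_ball.2 ?_⟩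
    linarith
  simpa only [hU, Function.comp_def] using tendsto_measure_iUnion_atTop (μ := μ) hmono

theorem RealizesPmGH.pushforwardIsMeasure (h : RealizesPmGH p m q μ R ε ψ)
    (hω : (ω : Filter ℕ) ≤ atTop) (hm : ∀ i, BoundedlyFinite (m i)) (hμ : BoundedlyFinite μ)
    (hφ : ∀ i, 4 * ε i < R i → IsQuasiInverse (R i) (ε i) (p i) q (ψ i) (φ i)) :
    PushforwardIsMeasure ω p m := by
  have hmeas := h.measurable_limitMap hω hφ
  have key : ∀ B : Set (Ultralimit ω p), MeasurableSet B →
      barMeasure ω p m (proj ω p ⁻¹' B) = μ (limitMap ω p φ ⁻¹' B) := fun B hB =>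
    (h.barSigma_and_barMeasure hω hm hμ hφ (hmeas hB)).2
  refine ⟨by rw [key ∅ MeasurableSet.empty, Set.preimage_empty, measure_empty], fun f hf hd => ?_⟩
  rw [key _ (MeasurableSet.iUnion hf), Set.preimage_iUnion,
    measure_iUnion (fun i j hij => (hd hij).preimage _) fun n => hmeas (hf n)]
  exact tsum_congr fun n => (key _ (hf n)).symm

theorem RealizesPmGH.map_limitMap (h : RealizesPmGH p m q μ R ε ψ)
    (hω : (ω : Filter ℕ) ≤ atTop) (hm : ∀ i, BoundedlyFinite (m i)) (hμ : BoundedlyFinite μ)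
    (hφ : ∀ i, 4 * ε i < R i → IsQuasiInverse (R i) (ε i) (p i) q (ψ i) (φ i)) :
    μ.map (limitMap ω p φ) = ultralimitMeasure ω p m := by
  have hmeas := h.measurable_limitMap hω hφ
  ext B hB
  rw [Measure.map_apply hmeas hB,
    ultralimitMeasure_apply (h.pushforwardIsMeasure hω hm hμ hφ) hB,
    (h.barSigma_and_barMeasure hω hm hμ hφ (hmeas hB)).2]

theorem RealizesPmGH.ultralimitMeasureWellPosed (h : RealizesPmGH p m q μ R ε ψ)
    (hω : (ω : Filter ℕ) ≤ atTop) (hm : ∀ i, BoundedlyFinite (m i)) (hμ : BoundedlyFinite μ)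
    (hφ : ∀ i, 4 * ε i < R i → IsQuasiInverse (R i) (ε i) (p i) q (ψ i) (φ i)) :
    UltralimitMeasureWellPosed ω p m where
  bounded := h.uniformlyBoundedlyFinite hω hm hμ
  isMeasure := h.pushforwardIsMeasure hω hm hμ hφ
  mem_barSigma _ hB :=
    (h.barSigma_and_barMeasure hω hm hμ hφ (h.measurable_limitMap hω hφ hB)).1
  apply_eq _ hB := ultralimitMeasure_apply (h.pushforwardIsMeasure hω hm hμ hφ) hB

theorem RealizesPmGH.spt_ultralimitMeasure (h : RealizesPmGH p m q μ R ε ψ)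
    (hω : (ω : Filter ℕ) ≤ atTop) (hm : ∀ i, BoundedlyFinite (m i)) (hμ : BoundedlyFinite μ)
    (hφ : ∀ i, 4 * ε i < R i → IsQuasiInverse (R i) (ε i) (p i) q (ψ i) (φ i)) :
    spt (ultralimitMeasure ω p m) = limitMap ω p φ '' spt μ := by
  rw [← h.map_limitMap hω hm hμ hφ]
  exact spt_map_of_isometry measurableSet_ballSigma_ball (h.isometry_limitMap hω hφ)
    (h.measurable_limitMap hω hφ) μ

theorem RealizesPmGH.ultralimitMeasure_image (h : RealizesPmGH p m q μ R ε ψ)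
    (hω : (ω : Filter ℕ) ≤ atTop) (hm : ∀ i, BoundedlyFinite (m i)) (hμ : BoundedlyFinite μ)
    (hφ : ∀ i, 4 * ε i < R i → IsQuasiInverse (R i) (ε i) (p i) q (ψ i) (φ i))
    {E : Set Y} (hE : MeasurableSet E) :
    MeasurableSet (limitMap ω p φ '' E) ∧
      ultralimitMeasure ω p m (limitMap ω p φ '' E) = μ E := by
  have hiso := h.isometry_limitMap hω hφ
  have himg : MeasurableSet (limitMap ω p φ '' E) := measurableSet_ballSigma_image hiso hE
  refine ⟨himg, ?_⟩
  rw [← h.map_limitMap hω hm hμ hφ, Measure.map_apply (h.measurable_limitMap hω hφ) himg,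
    Set.preimage_image_eq _ hiso.injective]

/-- A relatively Borel subset of the support is pulled back by `e` to a Borel set of the limit
space, the support there being closed; its isometric image is ball-measurable with the right
measure. -/
theorem RealizesPmGH.exists_isometryEquiv_spt (h : RealizesPmGH p m q μ R ε ψ)
    (hω : (ω : Filter ℕ) ≤ atTop) (hm : ∀ i, BoundedlyFinite (m i)) (hμ : BoundedlyFinite μ)
    (hφ : ∀ i, 4 * ε i < R i → IsQuasiInverse (R i) (ε i) (p i) q (ψ i) (φ i)) :
    ∃ e : spt μ ≃ᵢ spt (ultralimitMeasure ω p m),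
      (∀ x, (e x : Ultralimit ω p) = limitMap ω p φ x) ∧
      ∀ B : Set (spt (ultralimitMeasure ω p m)), MeasurableSet[borel _] B →
        MeasurableSet (Subtype.val '' B) ∧
        ultralimitMeasure ω p m (Subtype.val '' B) = μ (Subtype.val '' (e ⁻¹' B)) := by
  have hiso := h.isometry_limitMap hω hφ
  have hspt := h.spt_ultralimitMeasure hω hm hμ hφ
  let e₀ : spt μ ≃ spt (ultralimitMeasure ω p m) :=
    (Equiv.Set.image (limitMap ω p φ) (spt μ) hiso.injective).trans (Equiv.setCongr hspt.symm)
  let e : spt μ ≃ᵢ spt (ultralimitMeasure ω p m) :=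
    ⟨e₀, fun x y => hiso (x : Y) (y : Y)⟩
  have he : ∀ x, (e x : Ultralimit ω p) = limitMap ω p φ x := fun x => rfl
  refine ⟨e, he, fun B hB => ?_⟩
  have hpre : MeasurableSet (e ⁻¹' B) := by
    have := e.continuous.borel_measurable
    rw [BorelSpace.measurable_eq (α := spt μ)]
    exact this hB
  have himg : Subtype.val '' B = limitMap ω p φ '' (Subtype.val '' (e ⁻¹' B)) := by
    rw [← e.surjective.image_preimage B, Set.image_image, Set.image_image,
      e.surjective.image_preimage B]
    exact Set.image_congr fun x _ => he x
  rw [himg]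
  exact h.ultralimitMeasure_image hω hm hμ hφ ((isClosed_spt μ).measurableSet.subtype_image hpre)

end UltralimitMeasure

end UltraMM

theorem mainTheorem4
    (ω : Ultrafilter ℕ) (hω : ∀ n : ℕ, ({n} : Set ℕ) ∉ ω)
    (X : ℕ → Type u) [∀ i, MetricSpace (X i)] [∀ i, CompleteSpace (X i)]
    [∀ i, TopologicalSpace.SeparableSpace (X i)]
    [∀ i, MeasurableSpace (X i)] [∀ i, BorelSpace (X i)]
    (p : ∀ i, X i) (m : ∀ i, Measure (X i)) (hm : ∀ i, BoundedlyFinite (m i))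
    (Xinf : Type v) [MetricSpace Xinf] [CompleteSpace Xinf]
    [TopologicalSpace.SeparableSpace Xinf] [MeasurableSpace Xinf] [BorelSpace Xinf]
    (pinf : Xinf) (minf : Measure Xinf) (hminf : BoundedlyFinite minf)
    (hconv : PmGHConverges p m pinf minf) :
    -- the ultralimit measure is well posed and concentrated on its support
    UltralimitMeasureWellPosed ω p m ∧
    MeasurableSet (spt (ultralimitMeasure ω p m)) ∧
    ultralimitMeasure ω p m (spt (ultralimitMeasure ω p m))ᶜ = 0 ∧
    -- for all approximations realising the convergence
    ∀ (R ε : ℕ → ℝ) (ψ : ∀ i, X i → Xinf), RealizesPmGH p m pinf minf R ε ψ →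
      -- quasi-inverses exist, and for every choice of them
      (∃ φ : ∀ i, Xinf → X i, ∀ i, 4 * ε i < R i →
        IsQuasiInverse (R i) (ε i) (p i) pinf (ψ i) (φ i)) ∧
      ∀ φ : ∀ i, Xinf → X i,
        (∀ i, 4 * ε i < R i → IsQuasiInverse (R i) (ε i) (p i) pinf (ψ i) (φ i)) →
        -- the limit map is a well-defined measurable pointed isometric embedding
        (∀ x, Ultraprod.mk ω (fun i => φ i x) ∈ finiteSet ω p) ∧
        Isometry (limitMap ω p φ) ∧
        limitMap ω p φ pinf = basePoint ω p ∧
        Measurable (limitMap ω p φ) ∧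
        -- the support and the measure of the ultralimit are the images under the limit map
        spt (ultralimitMeasure ω p m) = limitMap ω p φ '' spt minf ∧
        Measure.map (limitMap ω p φ) minf = ultralimitMeasure ω p m ∧
        -- the limit map restricts to an isomorphism between the supports
        ∃ e : spt minf ≃ᵢ spt (ultralimitMeasure ω p m),
          (∀ x, (e x : Ultralimit ω p) = limitMap ω p φ x) ∧
          ∀ B : Set (spt (ultralimitMeasure ω p m)), MeasurableSet[borel _] B →
            MeasurableSet (Subtype.val '' B) ∧
            ultralimitMeasure ω p m (Subtype.val '' B) = minf (Subtype.val '' (e ⁻¹' B)) := by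
  have hω' := ultra_le_atTop hω
  -- The first three claims do not mention approximating maps, so any one realisation with any
  -- quasi-inverses serves as a witness.
  obtain ⟨R₀, ε₀, ψ₀, h₀⟩ := hconv
  obtain ⟨φ₀, hφ₀⟩ := h₀.exists_quasiInverses
  have hspt := h₀.spt_ultralimitMeasure hω' hm hminf hφ₀
  have hsptm : MeasurableSet (spt (ultralimitMeasure ω p m)) := by
    rw [hspt]
    exact (h₀.ultralimitMeasure_image hω' hm hminf hφ₀ (isClosed_spt minf).measurableSet).1
  refine ⟨h₀.ultralimitMeasureWellPosed hω' hm hminf hφ₀, hsptm, ?_, ?_⟩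
  · rw [← h₀.map_limitMap hω' hm hminf hφ₀] at hspt hsptm ⊢
    rw [Measure.map_apply (h₀.measurable_limitMap hω' hφ₀) hsptm.compl, hspt, Set.preimage_compl,
      Set.preimage_image_eq _ (h₀.isometry_limitMap hω' hφ₀).injective]
    exact measure_compl_spt minf
  · intro R ε ψ h
    refine ⟨h.exists_quasiInverses, fun φ hφ => ?_⟩
    exact ⟨h.mk_mem_finiteSet hω' hφ, h.isometry_limitMap hω' hφ, h.limitMap_base hω' hφ,
      h.measurable_limitMap hω' hφ, h.spt_ultralimitMeasure hω' hm hminf hφ,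
      h.map_limitMap hω' hm hminf hφ, h.exists_isometryEquiv_spt hω' hm hminf hφ⟩
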